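/- Let $(s)_k=s(s+1)\cdots(s+k-1)$ be the Pochhammer symbol, and let ${}_2F_1(\alpha,\beta;\gamma;z)$ denote the analytic continuation to $\mathbb{C}\setminus[1,\infty)$ of the Gauss series $\sum_{k\ge0}\frac{(\alpha)_k(\beta)_k}{(\gamma)_k\,k!}z^k$ $(|z|<1)$. Let $a,b_1,b_2,c_1,c_2\in\mathbb{C}$ with $c_1\notin\{0,-1,-2,\dots\}$ and $a+b_2-c_2+1\notin\{0,-1,-2,\dots\}$, and let Olsson's function $F_P(a,b_1,b_2,c_1,c_2;x,y)$ be the analytic continuation of the double power series $$\sum_{i,j=0}^{\infty}\frac{(a)_{i+j}\,(a-c_2+1)_i\,(b_1)_i\,(b_2)_j}{(a+b_2-c_2+1)_{i+j}\,(c_1)_i\,i!\,j!}\,x^i(1-y)^j\qquad(|x|<1,\ |y-1|<1)$$ to the region $\Omega=\{(x,y)\in\mathbb{C}^2 : x\notin[1,\infty),\ y\notin(-\infty,0]\}$. Suppose that $\operatorname{Re}a>0$, $\operatorname{Re}(a-c_2+1)>0$ and $\operatorname{Re}(b_2+c_1-a)>0$. Then the analytic continuation $F_P$ to $\Omega$ exists,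 and for all $(x,y)\in\Omega$ $$F_P(a,b_1,b_2,c_1,c_2;x,y)=\frac{\Gamma(c_1)\,\Gamma(a+b_2-c_2+1)}{\Gamma(a)\,\Gamma(a-c_2+1)\,\Gamma(b_2+c_1-a)}\;y^{-b_2}\int_0^1 u^{a-b_2-1}(1-u)^{b_2+c_1-a-1}(1-xu)^{-b_1}\,{}_2F_1\!\left(b_2,\,b_2-c_2+1;\,b_2+c_1-a;\,y^{-1}(1-u^{-1})\right)du,$$ where the integral converges absolutely and all powers take their principal values. -/

import Mathlib

open scoped Nat

noncomputable section

/-- The complex plane with the cut `[1, ∞)` removed. -/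
def planeMinusOneInfty : Set ℂ := {z | z ∉ ((↑) : ℝ → ℂ) '' Set.Ici 1}

/-- The complex plane with the cut `(-∞, 0]` removed. -/
def planeMinusNegReals : Set ℂ := {z | z ∉ ((↑) : ℝ → ℂ) '' Set.Iic 0}

open Classical in
/-- The analytic continuation of `f` from the set `U` to the set `V`: a function that is
holomorphic on `V` and agrees with `f` on `U`, whenever there is one (and `f` itself otherwise).
It is used only when `U` is a nonempty open subset of a connected open set `V`; its values on `V`
are then determined uniquely by the identity theorem. Its values outside `V` are irrelevant. -/
def analyticContinuation {E : Type*} [NormedAddCommGroup E] [NormedSpace ℂ E]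
    (f : E → ℂ) (U V : Set E) : E → ℂ :=
  if h : ∃ F : E → ℂ, DifferentiableOn ℂ F V ∧ Set.EqOn F f U then h.choose else f

/-- The Gauss hypergeometric function: the analytic continuation of the power series
`∑ₖ (a)ₖ (b)ₖ / ((c)ₖ k!) zᵏ` from the unit disk to `ℂ \ [1, ∞)`. -/
def gaussHypergeometric (a b c : ℂ) : ℂ → ℂ :=
  analyticContinuation (ordinaryHypergeometric a b c) (Metric.ball 0 1) planeMinusOneInfty

/-- The Pochhammer symbol `(a)ₖ = a (a + 1) ⋯ (a + k - 1)`. -/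
def poch (a : ℂ) (k : ℕ) : ℂ := (ascPochhammer ℂ k).eval a

/-- The double power series that defines Olsson's function `F_P` near `(0, 1)`. -/
def olssonFPSeries (a b₁ b₂ c₁ c₂ : ℂ) (p : ℂ × ℂ) : ℂ :=
  ∑' n : ℕ × ℕ,
    poch a (n.1 + n.2) * poch (a - c₂ + 1) n.1 * poch b₁ n.1 * poch b₂ n.2 /
      (poch (a + b₂ - c₂ + 1) (n.1 + n.2) * poch c₁ n.1 * (n.1 ! : ℂ) * (n.2 ! : ℂ)) *
      p.1 ^ n.1 * (1 - p.2) ^ n.2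

/-- The bidisk `|x| < 1`, `|y - 1| < 1` on which the double power series converges. -/
def olssonFPDisk : Set (ℂ × ℂ) := Metric.ball 0 1 ×ˢ Metric.ball 1 1

/-- The region `x ∉ [1, ∞)`, `y ∉ (-∞, 0]`. -/
def olssonFPDomain : Set (ℂ × ℂ) := planeMinusOneInfty ×ˢ planeMinusNegReals

/-- Olsson's function `F_P(a, b₁, b₂, c₁, c₂; x, y)`: the analytic continuation of the double
power series from the bidisk to the region `x ∉ [1, ∞)`, `y ∉ (-∞, 0]`. -/
def olssonFP (a b₁ b₂ c₁ c₂ : ℂ) : ℂ × ℂ → ℂ :=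
  analyticContinuation (olssonFPSeries a b₁ b₂ c₁ c₂) olssonFPDisk olssonFPDomain

/-- The integrand
`u^(a-b₂-1) (1-u)^(b₂+c₁-a-1) (1-xu)^(-b₁) ₂F₁(b₂, b₂-c₂+1; b₂+c₁-a; y⁻¹(1-u⁻¹))`,
with principal values of the powers. -/
def olssonFPIntegrand (a b₁ b₂ c₁ c₂ x y : ℂ) (u : ℝ) : ℂ :=
  (u : ℂ) ^ (a - b₂ - 1) * (1 - (u : ℂ)) ^ (b₂ + c₁ - a - 1) * (1 - x * (u : ℂ)) ^ (-b₁) *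
    gaussHypergeometric b₂ (b₂ - c₂ + 1) (b₂ + c₁ - a) (y⁻¹ * (1 - (u : ℂ)⁻¹))

end

open MeasureTheory Filter Topology

/-! Write `α = b₂`, `β = b₂ - c₂ + 1`, `γ = b₂ + c₁ - a`. The right-hand side is holomorphic on all
of `olssonFPDomain` and agrees with the double series on the bidisk. This gives both the existence
of the continuation and, by the identity theorem, the formula (`olssonFP_eqOn`).

On the bidisk, expand `(1 - x u) ^ (-b₁)` in powers of `x`. The factor `u ^ k` only replaces `a` by
`a + k`, so everything reduces to `x = 0` (`hasSum_fpIntegral`). There the integral is a Gamma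
quotient times `y ^ α` times the Gauss function with parameters `α, a; a + β` at `1 - y`
(`fpIntegral_zero`). Expanding this in powers of `1 - y` and turning Gamma quotients into Pochhammer
symbols gives the double series.

For `x = 0`, `Re β > 0`, `Re (γ - β) > 0` and `Re y > 0`, insert Euler's integral and substitute `q
= u + (1 - u) t`. The result is an integral over the triangle `0 < u < q < 1` of a homogeneous
kernel. Interchanging the integrals and setting `u = q r` splits it into a Beta integral in `q` and
an Euler integral in `r`. The theorem assumes neither `Re β > 0` nor `Re (γ - β) > 0`, so these are
removed by continuation along `β + t`, `γ + 2 t` (`fpIntegral_zero_of_im`).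

Two facts about the Gauss function support this: joint holomorphy in `(β, γ, z)`
(`differentiableOn_gaussHypergeometric`) and, along the rays `z = -v / y`, a bound by `(1 + v) ^
(-s)` for every `s < min (Re α) (Re β)` (`exists_norm_gaussHypergeometric_le`). Both hold for
Euler's integral and are carried to general parameters by one recurrence (`gaussCoeff_succ`) whose
terms all have larger `Re β` and `Re (γ - β)`. -/

theorem HasSum.of_eq {ι : Type*} {f g : ι → ℂ} {s : ℂ} (h : HasSum f s) (hfg : ∀ k, f k = g k) :
    HasSum g s :=
  funext hfg ▸ h

/-! ### Holomorphy of parameter integrals -/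

/-- A locally dominated integral of holomorphic functions is holomorphic. -/
theorem differentiableOn_setIntegral {E X : Type*} [NormedAddCommGroup E] [NormedSpace ℂ E]
    [FiniteDimensional ℂ E] [MeasurableSpace X] {μ : Measure X} {S : Set X}
    (hS : MeasurableSet S) {f : E → X → ℂ} {U : Set E} (hU : IsOpen U)
    (hmeas : ∀ p ∈ U, AEStronglyMeasurable (f p) (μ.restrict S))
    (hdiff : ∀ u ∈ S, DifferentiableOn ℂ (fun p => f p u) U)
    (hbound : ∀ p₀ ∈ U, ∃ g : X → ℝ, IntegrableOn g S μ ∧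
      ∀ᶠ p in 𝓝 p₀, ∀ u ∈ S, ‖f p u‖ ≤ g u) :
    DifferentiableOn ℂ (fun p => ∫ u in S, f p u ∂μ) U := by
  intro p₀ hp₀
  obtain ⟨g, hg, hfg⟩ := hbound p₀ hp₀
  have hUn : U ∈ 𝓝 p₀ := hU.mem_nhds hp₀
  obtain ⟨r, hr, hball⟩ := Metric.eventually_nhds_iff_ball.1 (hfg.and hUn)
  have hbU : Metric.ball p₀ r ⊆ U := fun p hp => (hball p hp).2
  have hdiffAt : ∀ u ∈ S, DifferentiableAt ℂ (fun p => f p u) p₀ := fun u hu =>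
    (hdiff u hu).differentiableAt hUn
  have hF'meas : AEStronglyMeasurable (fun u => fderiv ℂ (fun p => f p u) p₀) (μ.restrict S) := by
    let b := Module.finBasis ℂ E
    have hv : ∀ v : E, AEStronglyMeasurable (fun u => fderiv ℂ (fun p => f p u) p₀ v)
        (μ.restrict S) := by
      intro v
      obtain ⟨N, hN⟩ : ∃ N : ℕ, ∀ n ≥ N, p₀ + ((n : ℂ) + 1)⁻¹ • v ∈ U := by
        have h1 : Tendsto (fun n : ℕ => p₀ + ((n : ℂ) + 1)⁻¹ • v) atTop (𝓝 p₀) := by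
          have h2 : Tendsto (fun n : ℕ => ((n : ℂ) + 1)⁻¹) atTop (𝓝 0) := by
            simpa [one_div] using tendsto_one_div_add_atTop_nhds_zero_nat (𝕜 := ℂ)
          simpa using tendsto_const_nhds.add (h2.smul_const v)
        exact eventually_atTop.1 (h1 hUn)
      -- The derivative along `v` is a limit of difference quotients with step `1 / (n + N + 1)`.
      -- The shift by `N` keeps every sample point in `U`, where measurability is known.
      refine aestronglyMeasurable_of_tendsto_ae (u := atTop)
        (f := fun (n : ℕ) u => ((n + N : ℕ) + 1 : ℂ) *
          (f (p₀ + (((n + N : ℕ) : ℂ) + 1)⁻¹ • v) u - f p₀ u)) ?_ ?_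
      · intro n
        exact ((hmeas _ (hN _ (by omega))).sub (hmeas _ hp₀)).const_mul _
      · refine (ae_restrict_iff' hS).2 (Eventually.of_forall fun u hu => ?_)
        have hd := (hdiffAt u hu).hasFDerivAt
        have := hd.lim v (c := fun n : ℕ => (((n + N : ℕ) : ℂ) + 1)) (α := ℕ) (l := atTop) ?_
        · simpa using this
        · have h3 : Tendsto (fun n : ℕ => ‖((n : ℂ) + 1)‖) atTop atTop := by
            have : (fun n : ℕ => ‖((n : ℂ) + 1)‖) = fun n : ℕ => ((n + 1 : ℕ) : ℝ) := by
              ext n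
              have : ((n : ℂ) + 1) = ((n + 1 : ℕ) : ℂ) := by push_cast; rfl
              rw [this, Complex.norm_natCast]
            rw [this]
            exact tendsto_natCast_atTop_atTop.comp (tendsto_add_atTop_nat 1)
          exact h3.comp (tendsto_add_atTop_nat N)
    have hsum : (fun u => fderiv ℂ (fun p => f p u) p₀) = fun u => ∑ i,
        (fderiv ℂ (fun p => f p u) p₀ (b i)) • (b.coord i).toContinuousLinearMap := by
      ext u v
      conv_lhs => rw [← b.sum_repr v, map_sum]
      simp [mul_comm]
    rw [hsum]
    exact Finset.aestronglyMeasurable_fun_sum _ fun i _ => (hv (b i)).smul_const _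
  refine (hasFDerivAt_integral_of_dominated_loc_of_lip' (Metric.ball_mem_nhds p₀ hr)
    (bound := fun u => 2 * g u / r)
    (fun p hp => hmeas p (hbU hp)) ?_ hF'meas ?_ ((hg.const_mul 2).div_const r)
    ?_).2.differentiableAt.differentiableWithinAt
  · refine Integrable.mono' hg (hmeas _ hp₀) ?_
    exact (ae_restrict_iff' hS).2 (Eventually.of_forall fun u hu =>
      (hball p₀ (Metric.mem_ball_self hr)).1 u hu)
  · refine (ae_restrict_iff' hS).2 (Eventually.of_forall fun u hu p hp => ?_)
    rw [← dist_eq_norm, ← dist_eq_norm]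
    -- Schwarz's lemma: a bound `g u` on the values over the ball of radius `r` already yields the
    -- Lipschitz constant `2 * g u / r` at the centre, so no bound on derivatives has to be assumed.
    refine Complex.dist_le_div_mul_dist_of_mapsTo_ball (f := fun p => f p u)
      ((hdiff u hu).mono hbU) (fun q hq => ?_) hp
    rw [Metric.mem_closedBall, dist_eq_norm]
    have h1 := (hball q hq).1 u hu
    have h2 := (hball p₀ (Metric.mem_ball_self hr)).1 u hu
    exact (norm_sub_le _ _).trans (by linarith)
  · exact (ae_restrict_iff' hS).2 (Eventually.of_forall fun u hu => (hdiffAt u hu).hasFDerivAt)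

/-! ### Pochhammer symbols and the binomial series -/

theorem poch_zero (a : ℂ) : poch a 0 = 1 := by simp [poch]

theorem poch_succ (a : ℂ) (k : ℕ) : poch a (k + 1) = poch a k * (a + k) := by
  simp [poch, ascPochhammer_succ_eval]

theorem poch_succ_left (a : ℂ) (k : ℕ) : poch a (k + 1) = a * poch (a + 1) k := by
  simp [poch, ascPochhammer_succ_left, Polynomial.eval_comp]

theorem poch_add (a : ℂ) (m n : ℕ) : poch a (m + n) = poch a m * poch (a + m) n := by
  induction n with
  | zero => simp [poch_zero]
  | succ n ih => rw [← add_assoc, poch_succ, ih, poch_succ]; push_cast; ring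

theorem poch_one (k : ℕ) : poch 1 k = (k ! : ℂ) := by
  simp [poch]

theorem poch_ne_zero {c : ℂ} (hc : ∀ n : ℕ, c ≠ -(n : ℂ)) (k : ℕ) : poch c k ≠ 0 := by
  induction k with
  | zero => simp [poch_zero]
  | succ k ih =>
    rw [poch_succ]
    exact mul_ne_zero ih fun h => hc k (eq_neg_of_add_eq_zero_left h)

theorem Gamma_add_nat_eq_poch_mul {s : ℂ} (hs : ∀ n : ℕ, s ≠ -(n : ℂ)) (k : ℕ) :
    Complex.Gamma (s + k) = poch s k * Complex.Gamma s := by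
  induction k with
  | zero => simp [poch_zero]
  | succ k ih =>
    rw [poch_succ]
    push_cast
    rw [← add_assoc, Complex.Gamma_add_one _ fun h => hs k (eq_neg_of_add_eq_zero_left h), ih]
    ring

/-- Since `‖c + n‖ / (n + 1)` tends to `1` and never vanishes, it is at least some `ε > 0`. With `K
≥ ‖a - c‖ / ε`, each new factor satisfies `‖a + n‖ ≤ (1 + K / (n + 1)) * ‖c + n‖`. Bernoulli's
inequality bounds the bracket by `((n + 2) / (n + 1)) ^ K`, and these powers telescope. -/
theorem exists_norm_poch_le (a : ℂ) {c : ℂ} (hc : ∀ n : ℕ, c ≠ -(n : ℂ)) :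
    ∃ K : ℕ, ∀ n : ℕ, ‖poch a n‖ ≤ ((n : ℝ) + 1) ^ K * ‖poch c n‖ := by
  obtain ⟨ε, hε, hcε⟩ : ∃ ε > 0, ∀ n : ℕ, ε * ((n : ℝ) + 1) ≤ ‖c + n‖ := by
    have hlim : Tendsto (fun n : ℕ => ‖c + n‖ / ((n : ℝ) + 1)) atTop (𝓝 1) := by
      have h1 : Tendsto (fun n : ℕ => (c - 1) * ((n : ℂ) + 1)⁻¹ + 1) atTop (𝓝 1) := by
        have h2 : Tendsto (fun n : ℕ => ((n : ℂ) + 1)⁻¹) atTop (𝓝 0) := by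
          simpa [one_div] using tendsto_one_div_add_atTop_nhds_zero_nat (𝕜 := ℂ)
        simpa using (h2.const_mul (c - 1)).add_const 1
      have h3 := h1.norm
      rw [norm_one] at h3
      refine h3.congr fun n => ?_
      have hn : ((n : ℂ) + 1) ≠ 0 := by exact_mod_cast n.succ_ne_zero
      have : (c - 1) * ((n : ℂ) + 1)⁻¹ + 1 = (c + n) / ((n : ℂ) + 1) := by field_simp; ring
      have hnn : ‖(n : ℂ) + 1‖ = (n : ℝ) + 1 := by
        have : ((n : ℂ) + 1) = ((n + 1 : ℕ) : ℂ) := by push_cast; rfl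
        rw [this, Complex.norm_natCast]; push_cast; rfl
      rw [this, norm_div, hnn]
    obtain ⟨N, hN⟩ := eventually_atTop.1 (hlim.eventually (lt_mem_nhds (by norm_num : (1/2:ℝ) < 1)))
    have hpos : ∀ n : ℕ, 0 < ‖c + n‖ / ((n : ℝ) + 1) := fun n =>
      div_pos (norm_pos_iff.2 fun h => hc n (eq_neg_of_add_eq_zero_left h)) (by positivity)
    obtain ⟨δ, hδ, hδN⟩ : ∃ δ > 0, ∀ n < N, δ ≤ ‖c + n‖ / ((n : ℝ) + 1) := by
      rcases Nat.eq_zero_or_pos N with rfl | hNpos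
      · exact ⟨1, one_pos, by simp⟩
      · obtain ⟨m, -, hm⟩ := Finset.exists_min_image (Finset.range N)
          (fun n : ℕ => ‖c + n‖ / ((n : ℝ) + 1)) ⟨0, by simpa using hNpos⟩
        exact ⟨_, hpos m, fun n hn => hm n (by simpa using hn)⟩
    refine ⟨min δ (1 / 2), by positivity, fun n => ?_⟩
    rw [← le_div_iff₀ (by positivity)]
    rcases lt_or_ge n N with h | h
    · exact (min_le_left _ _).trans (hδN n h)
    · exact (min_le_right _ _).trans (hN n h).le
  obtain ⟨K, hK⟩ := exists_nat_ge (‖a - c‖ / ε)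
  refine ⟨K, fun n => ?_⟩
  induction n with
  | zero => simp [poch_zero]
  | succ n ih =>
    rw [poch_succ, poch_succ, norm_mul, norm_mul]
    have hn : (0 : ℝ) < (n : ℝ) + 1 := by positivity
    have h1 : ‖a + n‖ ≤ (1 + K * ((n : ℝ) + 1)⁻¹) * ‖c + n‖ := by
      have h2 : ‖a + n‖ ≤ ‖a - c‖ + ‖c + n‖ := by
        have : a + n = (a - c) + (c + n) := by ring
        rw [this]; exact norm_add_le _ _
      have h3 : ‖a - c‖ ≤ K * ((n : ℝ) + 1)⁻¹ * ‖c + n‖ := by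
        calc ‖a - c‖ ≤ K * ε := by rwa [div_le_iff₀ hε] at hK
          _ = K * ((n : ℝ) + 1)⁻¹ * (ε * ((n : ℝ) + 1)) := by field_simp
          _ ≤ _ := by gcongr; exact hcε n
      linarith
    have h4 : 1 + K * ((n : ℝ) + 1)⁻¹ ≤ (1 + ((n : ℝ) + 1)⁻¹) ^ K :=
      one_add_mul_le_pow (by have : (0 : ℝ) ≤ ((n : ℝ) + 1)⁻¹ := by positivity
                             linarith) K
    calc ‖poch a n‖ * ‖a + n‖
        ≤ (((n : ℝ) + 1) ^ K * ‖poch c n‖) * ((1 + ((n : ℝ) + 1)⁻¹) ^ K * ‖c + n‖) := by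
          gcongr
          exact h1.trans (by gcongr)
      _ = (((n : ℝ) + 1) * (1 + ((n : ℝ) + 1)⁻¹)) ^ K * (‖poch c n‖ * ‖c + n‖) := by
          rw [mul_pow]; ring
      _ = _ := by
          congr 2
          push_cast
          field_simp

theorem summable_add_one_pow_mul_pow (K : ℕ) {r : ℝ} (h0 : 0 ≤ r) (hr : r < 1) :
    Summable fun n : ℕ => ((n : ℝ) + 1) ^ K * r ^ n := by
  rcases h0.eq_or_lt with rfl | h0
  · exact summable_of_ne_finset_zero (s := {0}) fun n hn => by
      simp only [Finset.mem_singleton] at hn; simp [hn]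
  · have h := (summable_nat_add_iff 1).2
      (summable_pow_mul_geometric_of_norm_lt_one K (r := r) (by rwa [Real.norm_of_nonneg h0.le]))
    refine (h.mul_left r⁻¹).congr fun n => ?_
    push_cast
    field_simp
    ring

theorem hasSum_one_sub_cpow_neg (α : ℂ) {w : ℂ} (hw : ‖w‖ < 1) :
    HasSum (fun k : ℕ => poch α k / (k ! : ℂ) * w ^ k) ((1 - w) ^ (-α)) := by
  have h := (Complex.one_add_cpow_hasFPowerSeriesOnBall_zero (a := -α)).hasSum (y := -w)
    (by simpa [← ofReal_norm] using hw)
  -- The parameter `b` occurs both above and below and cancels; `1` is an admissible choice because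
  -- its Pochhammer symbols do not vanish.
  rw [binomialSeries_eq_ordinaryHypergeometricSeries (b := (1 : ℂ))
    (by intro k h; have := congrArg Complex.re h; simp at this; linarith [k.cast_nonneg (α := ℝ)])]
    at h
  rw [zero_add, ← sub_eq_add_neg] at h
  refine h.of_eq fun k => ?_
  rw [FormalMultilinearSeries.compContinuousLinearMap_apply]
  have : ((-ContinuousLinearMap.id ℂ ℂ) ∘ fun _ : Fin k => -w) = fun _ => w := by ext; simp
  rw [this, ordinaryHypergeometricSeries_apply_eq, neg_neg]
  have hk : (ascPochhammer ℂ k).eval 1 ≠ 0 := by simp [Nat.factorial_ne_zero]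
  rw [mul_assoc, mul_inv_cancel₀ hk, smul_eq_mul, poch]
  ring

theorem exists_norm_poch_div_factorial_le (a : ℂ) :
    ∃ K : ℕ, ∀ n : ℕ, ‖poch a n / (n ! : ℂ)‖ ≤ ((n : ℝ) + 1) ^ K := by
  obtain ⟨K, hK⟩ := exists_norm_poch_le a (c := 1)
    (by intro n h; have := congrArg Complex.re h; simp at this; linarith [n.cast_nonneg (α := ℝ)])
  refine ⟨K, fun n => ?_⟩
  have h3 : 0 < ‖(n ! : ℂ)‖ := norm_pos_iff.2 (by exact_mod_cast n.factorial_ne_zero)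
  rw [norm_div, div_le_iff₀ h3]
  simpa only [poch_one] using hK n

/-! ### Cut planes and uniqueness of the continuation -/

theorem mem_planeMinusOneInfty_iff {z : ℂ} :
    z ∈ planeMinusOneInfty ↔ 1 - z ∈ Complex.slitPlane := by
  simp only [planeMinusOneInfty, Set.mem_ofPred_eq, Set.mem_image, Set.mem_Ici,
    Complex.mem_slitPlane_iff, Complex.sub_re, Complex.sub_im, Complex.one_re, Complex.one_im]
  constructor
  · intro h
    by_contra! hc
    exact h ⟨z.re, by linarith [hc.1], Complex.ext rfl (by simp only [Complex.ofReal_im]; linarith [hc.2])⟩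
  · rintro h ⟨x, hx, rfl⟩
    simp at h
    linarith

theorem planeMinusNegReals_eq : planeMinusNegReals = Complex.slitPlane := by
  ext z
  simp only [planeMinusNegReals, Set.mem_ofPred_eq, Set.mem_image, Set.mem_Iic,
    Complex.mem_slitPlane_iff]
  constructor
  · intro h
    by_contra! hc
    exact h ⟨z.re, hc.1, Complex.ext rfl hc.2.symm⟩
  · rintro h ⟨x, hx, rfl⟩
    simp at h
    linarith

theorem isOpen_planeMinusOneInfty : IsOpen planeMinusOneInfty := by
  have : planeMinusOneInfty = (fun z : ℂ => 1 - z) ⁻¹' Complex.slitPlane := by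
    ext z; exact mem_planeMinusOneInfty_iff
  rw [this]
  exact Complex.isOpen_slitPlane.preimage (by fun_prop)

theorem isPreconnected_slitPlane : IsPreconnected Complex.slitPlane :=
  (Complex.starConvex_one_slitPlane.isPathConnected Complex.one_mem_slitPlane).isConnected.isPreconnected

theorem isPreconnected_planeMinusOneInfty : IsPreconnected planeMinusOneInfty := by
  have : planeMinusOneInfty = (fun z : ℂ => 1 - z) '' Complex.slitPlane := by
    ext z
    rw [mem_planeMinusOneInfty_iff]
    exact ⟨fun h => ⟨1 - z, h, by ring⟩, by rintro ⟨w, hw, rfl⟩; simpa using hw⟩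
  rw [this]
  exact isPreconnected_slitPlane.image _ (by fun_prop)

theorem mem_planeMinusOneInfty_of_norm_lt_one {z : ℂ} (hz : ‖z‖ < 1) : z ∈ planeMinusOneInfty := by
  rw [mem_planeMinusOneInfty_iff]
  left
  simpa using (Complex.re_le_norm z).trans_lt hz

/-- The identity theorem for holomorphic functions on a connected open set. -/
theorem eqOn_of_eqOn_open {f g : ℂ → ℂ} {U V : Set ℂ} (hV : IsOpen V) (hVc : IsPreconnected V)
    (hU : IsOpen U) (hUV : U ⊆ V) (hne : U.Nonempty) (hf : DifferentiableOn ℂ f V)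
    (hg : DifferentiableOn ℂ g V) (h : Set.EqOn f g U) : Set.EqOn f g V := by
  obtain ⟨z, hz⟩ := hne
  exact (hf.analyticOnNhd hV).eqOn_of_preconnected_of_eventuallyEq (hg.analyticOnNhd hV) hVc
    (hUV hz) (h.eventuallyEq_of_mem (hU.mem_nhds hz))

/-- The continuation is defined by choice. Any holomorphic candidate `F` shows that a continuation
exists and, by the identity theorem, equals the chosen one; formulas for the continuation are
obtained by exhibiting such an `F`. -/
theorem gaussHypergeometric_eqOn {α β γ : ℂ} {F : ℂ → ℂ} (hF : DifferentiableOn ℂ F planeMinusOneInfty)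
    (h : Set.EqOn F (ordinaryHypergeometric α β γ) (Metric.ball 0 1)) :
    Set.EqOn (gaussHypergeometric α β γ) F planeMinusOneInfty := by
  have hex : ∃ F : ℂ → ℂ, DifferentiableOn ℂ F planeMinusOneInfty ∧
      Set.EqOn F (ordinaryHypergeometric α β γ) (Metric.ball 0 1) := ⟨F, hF, h⟩
  rw [gaussHypergeometric, analyticContinuation, dif_pos hex]
  refine eqOn_of_eqOn_open isOpen_planeMinusOneInfty isPreconnected_planeMinusOneInfty
    Metric.isOpen_ball (fun z hz => mem_planeMinusOneInfty_of_norm_lt_one (by simpa using hz))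
    ⟨0, by simp⟩ hex.choose_spec.1 hF (hex.choose_spec.2.trans h.symm)

/-- The coefficients of the Gauss series. -/
noncomputable def gaussCoeff (α β γ : ℂ) (k : ℕ) : ℂ := poch α k * poch β k / (poch γ k * (k ! : ℂ))

theorem ordinaryHypergeometric_eq_tsum_gaussCoeff (α β γ z : ℂ) :
    ordinaryHypergeometric α β γ z = ∑' k, gaussCoeff α β γ k * z ^ k := by
  rw [ordinaryHypergeometric_eq_tsum]
  refine tsum_congr fun k => ?_
  rw [smul_eq_mul, gaussCoeff, poch, poch, poch]
  field_simp

theorem hasSum_ordinaryHypergeometric (α β : ℂ) {γ z : ℂ} (hγ : ∀ n : ℕ, γ ≠ -(n : ℂ))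
    (hz : ‖z‖ < 1) :
    HasSum (fun k => gaussCoeff α β γ k * z ^ k) (ordinaryHypergeometric α β γ z) := by
  rw [ordinaryHypergeometric_eq_tsum_gaussCoeff]
  refine Summable.hasSum ?_
  obtain ⟨K, hK⟩ := exists_norm_poch_le α hγ
  obtain ⟨K', hK'⟩ := exists_norm_poch_div_factorial_le β
  refine Summable.of_norm_bounded (summable_add_one_pow_mul_pow (K + K') (norm_nonneg z) hz)
    fun k => ?_
  rw [norm_mul, norm_pow]
  gcongr
  have h1 : 0 < ‖poch γ k‖ := norm_pos_iff.2 (poch_ne_zero hγ k)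
  have h2 : gaussCoeff α β γ k = poch α k / poch γ k * (poch β k / (k ! : ℂ)) := by
    rw [gaussCoeff, div_mul_div_comm]
  rw [h2, norm_mul, pow_add]
  gcongr
  · rw [norm_div, div_le_iff₀ h1]
    exact hK k
  · exact hK' k

/-! ### Beta integrals and Euler's integral -/

theorem norm_ofReal_cpow_mul_le {β δ : ℂ} {b d : ℝ} (hb : b ≤ β.re) (hd : d ≤ δ.re) {t : ℝ}
    (ht : t ∈ Set.Ioo (0 : ℝ) 1) :
    ‖(t : ℂ) ^ (β - 1) * (1 - (t : ℂ)) ^ (δ - 1)‖ ≤ t ^ (b - 1) * (1 - t) ^ (d - 1) := by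
  have h1 : (0 : ℝ) < 1 - t := sub_pos.2 ht.2
  have h2 : (1 - (t : ℂ)) = ((1 - t : ℝ) : ℂ) := by push_cast; rfl
  rw [h2, norm_mul, Complex.norm_cpow_eq_rpow_re_of_pos ht.1,
    Complex.norm_cpow_eq_rpow_re_of_pos h1]
  simp only [Complex.sub_re, Complex.one_re]
  exact mul_le_mul (Real.rpow_le_rpow_of_exponent_ge ht.1 ht.2.le (by linarith))
    (Real.rpow_le_rpow_of_exponent_ge h1 (by linarith [ht.1]) (by linarith))
    (Real.rpow_nonneg h1.le _) (Real.rpow_nonneg ht.1.le _)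

theorem integrableOn_cpow_mul_cpow {β δ : ℂ} (hβ : 0 < β.re) (hδ : 0 < δ.re) :
    IntegrableOn (fun t : ℝ => (t : ℂ) ^ (β - 1) * (1 - (t : ℂ)) ^ (δ - 1)) (Set.Ioo 0 1) := by
  have h := Complex.betaIntegral_convergent hβ hδ
  rw [intervalIntegrable_iff_integrableOn_Ioo_of_le zero_le_one] at h
  exact h

theorem integrableOn_rpow_mul_rpow {b d : ℝ} (hb : 0 < b) (hd : 0 < d) :
    IntegrableOn (fun t : ℝ => t ^ (b - 1) * (1 - t) ^ (d - 1)) (Set.Ioo 0 1) := by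
  have h := (integrableOn_cpow_mul_cpow (β := b) (δ := d) (by simpa) (by simpa)).norm
  refine IntegrableOn.congr_fun h (fun t ht => ?_) measurableSet_Ioo
  have h1 : (0 : ℝ) < 1 - t := sub_pos.2 ht.2
  have h2 : (1 - (t : ℂ)) = ((1 - t : ℝ) : ℂ) := by push_cast; rfl
  rw [h2, norm_mul, Complex.norm_cpow_eq_rpow_re_of_pos ht.1,
    Complex.norm_cpow_eq_rpow_re_of_pos h1]
  simp

theorem setIntegral_cpow_mul_cpow {β δ : ℂ} (hβ : 0 < β.re) (hδ : 0 < δ.re) :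
    ∫ t in Set.Ioo (0 : ℝ) 1, (t : ℂ) ^ (β - 1) * (1 - (t : ℂ)) ^ (δ - 1) =
      Complex.Gamma β * Complex.Gamma δ / Complex.Gamma (β + δ) := by
  rw [← Complex.betaIntegral_eq_Gamma_mul_div β δ hβ hδ, Complex.betaIntegral,
    intervalIntegral.integral_of_le zero_le_one, integral_Ioc_eq_integral_Ioo]

theorem ofReal_mem_Ioo_slitPlane {t : ℝ} (ht : t ∈ Set.Ioo (0 : ℝ) 1) :
    (t : ℂ) ∈ Complex.slitPlane ∧ 1 - (t : ℂ) ∈ Complex.slitPlane := by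
  refine ⟨Complex.ofReal_mem_slitPlane.2 ht.1, ?_⟩
  have h2 : (1 - (t : ℂ)) = ((1 - t : ℝ) : ℂ) := by push_cast; rfl
  rw [h2]
  exact Complex.ofReal_mem_slitPlane.2 (sub_pos.2 ht.2)

theorem one_sub_mul_mem_slitPlane {z : ℂ} (hz : z ∈ planeMinusOneInfty) {t : ℝ}
    (ht : t ∈ Set.Icc (0 : ℝ) 1) : 1 - z * t ∈ Complex.slitPlane := by
  have h := Complex.starConvex_one_slitPlane (mem_planeMinusOneInfty_iff.1 hz)
    (sub_nonneg.2 ht.2) ht.1 (by ring)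
  convert h using 1
  simp only [Complex.real_smul]
  push_cast
  ring

theorem continuousOn_one_sub_mul_cpow (α : ℂ) :
    ContinuousOn (fun p : ℂ × ℝ => (1 - p.1 * (p.2 : ℂ)) ^ (-α))
      (planeMinusOneInfty ×ˢ Set.Icc (0 : ℝ) 1) := by
  refine ContinuousOn.cpow_const (by fun_prop) fun p hp => one_sub_mul_mem_slitPlane hp.1 hp.2

/-- Continuity on the compact product of a small closed ball around `z₀` and `[0, 1]`. -/
theorem exists_norm_one_sub_mul_cpow_le (α : ℂ) {z₀ : ℂ} (hz₀ : z₀ ∈ planeMinusOneInfty) :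
    ∃ C > 0, ∀ᶠ z in 𝓝 z₀, ∀ t ∈ Set.Icc (0 : ℝ) 1, ‖(1 - z * (t : ℂ)) ^ (-α)‖ ≤ C := by
  obtain ⟨r, hr, hball⟩ := Metric.nhds_basis_closedBall.mem_iff.1
    (isOpen_planeMinusOneInfty.mem_nhds hz₀)
  obtain ⟨C, hC⟩ := ((isCompact_closedBall z₀ r).prod
    (isCompact_Icc (a := (0 : ℝ)) (b := 1))).exists_bound_of_continuousOn
    ((continuousOn_one_sub_mul_cpow α).mono (Set.prod_mono hball subset_rfl))
  refine ⟨max C 1, by positivity, ?_⟩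
  filter_upwards [Metric.closedBall_mem_nhds z₀ hr] with z hz t ht
  exact (hC (z, t) ⟨hz, ht⟩).trans (le_max_left _ _)

/-- Termwise integration of the binomial series of `(1 - x t) ^ (-b)`. -/
theorem hasSum_setIntegral_one_sub_mul_cpow (b : ℂ) {x : ℂ} (hx : ‖x‖ < 1) {g : ℝ → ℂ}
    (hg : IntegrableOn g (Set.Ioo 0 1)) :
    HasSum (fun k : ℕ => poch b k / (k ! : ℂ) * x ^ k * ∫ t in Set.Ioo (0 : ℝ) 1, (t : ℂ) ^ k * g t)
      (∫ t in Set.Ioo (0 : ℝ) 1, (1 - x * (t : ℂ)) ^ (-b) * g t) := by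
  obtain ⟨K, hK⟩ := exists_norm_poch_div_factorial_le b
  have hsum := summable_add_one_pow_mul_pow K (norm_nonneg x) hx
  have key := hasSum_integral_of_dominated_convergence (μ := volume.restrict (Set.Ioo (0 : ℝ) 1))
    (F := fun (k : ℕ) (t : ℝ) => poch b k / (k ! : ℂ) * x ^ k * ((t : ℂ) ^ k * g t))
    (f := fun t : ℝ => (1 - x * (t : ℂ)) ^ (-b) * g t)
    (fun k t => ((k : ℝ) + 1) ^ K * ‖x‖ ^ k * ‖g t‖) ?_ ?_ ?_ ?_ ?_
  · simpa only [integral_const_mul] using key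
  · intro k
    have : Continuous fun t : ℝ => (t : ℂ) ^ k := by fun_prop
    exact (this.aestronglyMeasurable.mul hg.aestronglyMeasurable).const_mul _
  · intro k
    refine (ae_restrict_iff' measurableSet_Ioo).2 (Eventually.of_forall fun t ht => ?_)
    rw [norm_mul, norm_mul, norm_mul, norm_pow, norm_pow, Complex.norm_of_nonneg ht.1.le]
    have h1 : t ^ k * ‖g t‖ ≤ ‖g t‖ :=
      mul_le_of_le_one_left (norm_nonneg _) (pow_le_one₀ ht.1.le ht.2.le)
    have h0 : 0 ≤ t ^ k * ‖g t‖ := mul_nonneg (pow_nonneg ht.1.le _) (norm_nonneg _)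
    gcongr
    exact hK k
  · exact Eventually.of_forall fun t => hsum.mul_right _
  · simp_rw [tsum_mul_right]
    exact hg.norm.const_mul _
  · refine (ae_restrict_iff' measurableSet_Ioo).2 (Eventually.of_forall fun t ht => ?_)
    have hxt : ‖x * (t : ℂ)‖ < 1 := by
      rw [norm_mul, Complex.norm_of_nonneg ht.1.le]
      exact (mul_le_of_le_one_right (norm_nonneg _) ht.2.le).trans_lt hx
    refine ((hasSum_one_sub_cpow_neg b hxt).mul_right (g t)).of_eq fun k => ?_
    rw [mul_pow]
    ring

/-- Euler's integral. -/
noncomputable def eulerIntegral (α β γ z : ℂ) : ℂ :=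
  ∫ t in Set.Ioo (0 : ℝ) 1,
    (t : ℂ) ^ (β - 1) * (1 - (t : ℂ)) ^ (γ - β - 1) * (1 - z * (t : ℂ)) ^ (-α)

/-- The domain of Euler's integral. -/
def eulerDomain : Set (ℂ × ℂ × ℂ) :=
  {p | 0 < p.1.re ∧ 0 < (p.2.1 - p.1).re ∧ p.2.2 ∈ planeMinusOneInfty}

theorem isOpen_eulerDomain : IsOpen eulerDomain := by
  have h1 : IsOpen {p : ℂ × ℂ × ℂ | 0 < p.1.re} := isOpen_lt (by fun_prop) (by fun_prop)
  have h2 : IsOpen {p : ℂ × ℂ × ℂ | 0 < (p.2.1 - p.1).re} := isOpen_lt (by fun_prop) (by fun_prop)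
  have h3 : IsOpen {p : ℂ × ℂ × ℂ | p.2.2 ∈ planeMinusOneInfty} :=
    isOpen_planeMinusOneInfty.preimage (by fun_prop)
  exact h1.inter (h2.inter h3)

theorem differentiableOn_eulerIntegral (α : ℂ) :
    DifferentiableOn ℂ (fun p : ℂ × ℂ × ℂ => eulerIntegral α p.1 p.2.1 p.2.2) eulerDomain := by
  refine differentiableOn_setIntegral measurableSet_Ioo isOpen_eulerDomain ?_ ?_ ?_
  · intro p hp
    refine ContinuousOn.aestronglyMeasurable (fun t ht => ?_) measurableSet_Ioo
    have h1 := ofReal_mem_Ioo_slitPlane ht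
    have h2 := one_sub_mul_mem_slitPlane hp.2.2 (Set.Ioo_subset_Icc_self ht)
    refine ContinuousAt.continuousWithinAt ?_
    refine ((ContinuousAt.cpow (by fun_prop) (by fun_prop) h1.1).mul
      (ContinuousAt.cpow (by fun_prop) (by fun_prop) h1.2)).mul
      (ContinuousAt.cpow (by fun_prop) (by fun_prop) h2)
  · intro t ht p hp
    have h1 := ofReal_mem_Ioo_slitPlane ht
    have h2 := one_sub_mul_mem_slitPlane hp.2.2 (Set.Ioo_subset_Icc_self ht)
    refine DifferentiableAt.differentiableWithinAt ?_
    refine ((DifferentiableAt.const_cpow (by fun_prop) (Or.inl (Complex.slitPlane_ne_zero h1.1))).mul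
      (DifferentiableAt.const_cpow (by fun_prop) (Or.inl (Complex.slitPlane_ne_zero h1.2)))).mul
      (DifferentiableAt.cpow_const (by fun_prop) h2)
  · rintro ⟨β₀, γ₀, z₀⟩ ⟨hβ, hγ, hz⟩
    simp only at hβ hγ hz
    obtain ⟨C, hC0, hC⟩ := exists_norm_one_sub_mul_cpow_le α hz
    refine ⟨fun t => t ^ (β₀.re / 2 - 1) * (1 - t) ^ ((γ₀ - β₀).re / 2 - 1) * C,
      (integrableOn_rpow_mul_rpow (half_pos hβ) (half_pos hγ)).mul_const C, ?_⟩
    have e1 : ∀ᶠ p : ℂ × ℂ × ℂ in 𝓝 (β₀, γ₀, z₀), β₀.re / 2 < p.1.re :=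
      (isOpen_lt (by fun_prop) (by fun_prop)).mem_nhds (half_lt_self hβ)
    have e2 : ∀ᶠ p : ℂ × ℂ × ℂ in 𝓝 (β₀, γ₀, z₀), (γ₀ - β₀).re / 2 < (p.2.1 - p.1).re :=
      (isOpen_lt (by fun_prop) (by fun_prop)).mem_nhds (half_lt_self hγ)
    have e3 : Tendsto (fun p : ℂ × ℂ × ℂ => p.2.2) (𝓝 (β₀, γ₀, z₀)) (𝓝 z₀) :=
      Continuous.tendsto' (by fun_prop) _ _ rfl
    filter_upwards [e1, e2, e3.eventually hC] with p h1 h2 h3 t ht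
    rw [norm_mul]
    exact mul_le_mul (norm_ofReal_cpow_mul_le h1.le h2.le ht) (h3 t (Set.Ioo_subset_Icc_self ht))
      (norm_nonneg _) (mul_nonneg (Real.rpow_nonneg ht.1.le _)
        (Real.rpow_nonneg (sub_nonneg.2 ht.2.le) _))

theorem ne_neg_natCast_of_re_pos {s : ℂ} (hs : 0 < s.re) (n : ℕ) : s ≠ -(n : ℂ) := by
  rintro rfl
  simp at hs
  linarith [n.cast_nonneg (α := ℝ)]

/-- Termwise integration of the binomial series: the `k`-th term is a Beta integral with `β` shifted
to `β + k`. -/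
theorem eulerIntegral_eq_of_norm_lt_one (α : ℂ) {β γ z : ℂ} (hβ : 0 < β.re) (hγ : 0 < (γ - β).re)
    (hz : ‖z‖ < 1) : eulerIntegral α β γ z =
      Complex.Gamma β * Complex.Gamma (γ - β) / Complex.Gamma γ * ordinaryHypergeometric α β γ z := by
  have hγ' : 0 < γ.re := by rw [Complex.sub_re] at hγ; linarith
  have h := hasSum_setIntegral_one_sub_mul_cpow α hz (integrableOn_cpow_mul_cpow hβ hγ)
  have h2 := (hasSum_ordinaryHypergeometric α β (ne_neg_natCast_of_re_pos hγ') hz).mul_left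
    (Complex.Gamma β * Complex.Gamma (γ - β) / Complex.Gamma γ)
  have h3 : eulerIntegral α β γ z = ∫ t in Set.Ioo (0 : ℝ) 1, (1 - z * (t : ℂ)) ^ (-α) *
      ((t : ℂ) ^ (β - 1) * (1 - (t : ℂ)) ^ (γ - β - 1)) := by
    rw [eulerIntegral]
    exact integral_congr_ae (Eventually.of_forall fun t => mul_comm _ _)
  rw [h3]
  refine h.unique (h2.of_eq fun k => ?_)
  have h4 : ∫ t in Set.Ioo (0 : ℝ) 1, (t : ℂ) ^ k * ((t : ℂ) ^ (β - 1) *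
      (1 - (t : ℂ)) ^ (γ - β - 1)) = ∫ t in Set.Ioo (0 : ℝ) 1, (t : ℂ) ^ (β + k - 1) *
      (1 - (t : ℂ)) ^ (γ - β - 1) := by
    refine setIntegral_congr_fun measurableSet_Ioo fun t ht => ?_
    have : (t : ℂ) ≠ 0 := Complex.ofReal_ne_zero.2 ht.1.ne'
    rw [show β + k - 1 = k + (β - 1) by ring, Complex.cpow_add _ _ this, Complex.cpow_natCast]
    ring
  have hβk : 0 < (β + k).re := by simp; positivity
  rw [h4, setIntegral_cpow_mul_cpow hβk hγ, show β + k + (γ - β) = γ + k by ring,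
    Gamma_add_nat_eq_poch_mul (ne_neg_natCast_of_re_pos hβ),
    Gamma_add_nat_eq_poch_mul (ne_neg_natCast_of_re_pos hγ'), gaussCoeff]
  have h5 := Complex.Gamma_ne_zero_of_re_pos hγ'
  have h6 := poch_ne_zero (ne_neg_natCast_of_re_pos hγ') k
  field_simp

theorem gaussHypergeometric_eq_eulerIntegral (α : ℂ) {β γ z : ℂ} (hβ : 0 < β.re)
    (hγ : 0 < (γ - β).re) (hz : z ∈ planeMinusOneInfty) :
    gaussHypergeometric α β γ z = Complex.Gamma γ / (Complex.Gamma β * Complex.Gamma (γ - β)) *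
      eulerIntegral α β γ z := by
  have hγ' : 0 < γ.re := by rw [Complex.sub_re] at hγ; linarith
  refine gaussHypergeometric_eqOn (F := fun z => Complex.Gamma γ /
    (Complex.Gamma β * Complex.Gamma (γ - β)) * eulerIntegral α β γ z) ?_ ?_ hz
  · refine DifferentiableOn.const_mul ?_ _
    exact (differentiableOn_eulerIntegral α).comp (f := fun z => (β, γ, z)) (by fun_prop)
      fun z hz => ⟨hβ, hγ, hz⟩
  · intro z hz
    simp only
    rw [eulerIntegral_eq_of_norm_lt_one α hβ hγ (by simpa using hz)]
    have h1 := Complex.Gamma_ne_zero_of_re_pos hβ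
    have h2 := Complex.Gamma_ne_zero_of_re_pos hγ
    have h3 := Complex.Gamma_ne_zero_of_re_pos hγ'
    field_simp

/-! ### A recurrence that continues the Gauss function in its parameters -/

/-- Coefficient form of the recurrence. The last two series are multiplied by `z`, hence the index
`k` against `k + 1`. The shifts `(β + 1, γ + 2)` and `(β + 2, γ + 3)` raise both `β` and `γ - β` by
at least `1`, and the terms carrying `z` also raise `α` by `1`, which later compensates the growth
of `z`. -/
theorem gaussCoeff_succ (α β : ℂ) {γ : ℂ} (hγ : ∀ n : ℕ, γ ≠ -(n : ℂ)) (k : ℕ) :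
    gaussCoeff α β γ (k + 1) = gaussCoeff α (β + 1) (γ + 2) (k + 1) +
      α * (β + 1) / ((γ + 1) * (γ + 2)) * gaussCoeff (α + 1) (β + 2) (γ + 3) k -
      α * (γ - β) / (γ * (γ + 1)) * gaussCoeff (α + 1) (β + 1) (γ + 2) k := by
  have hne : ∀ n : ℕ, γ + n ≠ 0 := fun n h => hγ n (eq_neg_of_add_eq_zero_left h)
  have h0 : γ ≠ 0 := by simpa using hne 0
  have h1 : γ + 1 ≠ 0 := by simpa using hne 1
  have h2 : γ + 2 ≠ 0 := by simpa using hne 2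
  have h3 : γ + k + 1 ≠ 0 := by simpa [add_assoc] using hne (k + 1)
  have h4 : γ + 2 + k ≠ 0 := fun h => hne (k + 2) (by push_cast; linear_combination h)
  have hR : poch (γ + 2) k ≠ 0 := poch_ne_zero (fun n h => hne (n + 2) (by
    push_cast; linear_combination h)) k
  have hk : (k ! : ℂ) ≠ 0 := by exact_mod_cast k.factorial_ne_zero
  have hk1 : (k : ℂ) + 1 ≠ 0 := by exact_mod_cast k.succ_ne_zero
  have e1 : poch γ (k + 1) = γ * (γ + 1) * poch (γ + 2) k / (γ + k + 1) := by
    rw [eq_div_iff h3]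
    have := poch_succ γ (k + 1)
    rw [poch_succ_left γ (k + 1), poch_succ_left (γ + 1) k] at this
    rw [show γ + 1 + 1 = γ + 2 by ring] at this
    push_cast at this
    linear_combination -this
  have e2 : poch (γ + 3) k = poch (γ + 2) k * (γ + 2 + k) / (γ + 2) := by
    rw [eq_div_iff h2]
    have := poch_succ_left (γ + 2) k
    rw [poch_succ, show γ + 2 + 1 = γ + 3 by ring] at this
    linear_combination -this
  have e3 : (β + 1) * poch (β + 2) k = poch (β + 1) k * (β + 1 + k) := by
    rw [← poch_succ, poch_succ_left, show β + 1 + 1 = β + 2 by ring]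
  have e4 : ((k + 1)! : ℂ) = (k + 1) * (k ! : ℂ) := by
    rw [Nat.factorial_succ]; push_cast; rfl
  -- The factor `β + 1` is absorbed into the Pochhammer symbol, so that no division by `β + 1`,
  -- which may vanish, occurs.
  have e5 : α * (β + 1) / ((γ + 1) * (γ + 2)) * gaussCoeff (α + 1) (β + 2) (γ + 3) k =
      α / (γ + 1) * (poch (α + 1) k * (poch (β + 1) k * (β + 1 + k)) /
        (poch (γ + 2) k * (γ + 2 + k) * (k ! : ℂ))) := by
    rw [gaussCoeff, e2, ← e3]
    field_simp
  rw [e5]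
  simp only [gaussCoeff]
  rw [e1, e4, poch_succ_left α, poch_succ_left β, poch_succ (β + 1), poch_succ (γ + 2)]
  field_simp
  ring

theorem ordinaryHypergeometric_recurrence (α β : ℂ) {γ z : ℂ} (hγ : ∀ n : ℕ, γ ≠ -(n : ℂ))
    (hz : ‖z‖ < 1) :
    ordinaryHypergeometric α β γ z = ordinaryHypergeometric α (β + 1) (γ + 2) z +
      α * (β + 1) / ((γ + 1) * (γ + 2)) * z * ordinaryHypergeometric (α + 1) (β + 2) (γ + 3) z -
      α * (γ - β) / (γ * (γ + 1)) * z * ordinaryHypergeometric (α + 1) (β + 1) (γ + 2) z := by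
  have hγ' : ∀ m n : ℕ, γ + m ≠ -(n : ℂ) := fun m n h => hγ (m + n) (by
    push_cast; linear_combination h)
  have s0 := (hasSum_nat_add_iff' 1).2 (hasSum_ordinaryHypergeometric α β hγ hz)
  have s1 := (hasSum_nat_add_iff' 1).2
    (hasSum_ordinaryHypergeometric α (β + 1) (γ := γ + 2) (by exact_mod_cast hγ' 2) hz)
  have s2 := (hasSum_ordinaryHypergeometric (α + 1) (β + 2) (γ := γ + 3)
    (by exact_mod_cast hγ' 3) hz).mul_left (α * (β + 1) / ((γ + 1) * (γ + 2)) * z)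
  have s3 := (hasSum_ordinaryHypergeometric (α + 1) (β + 1) (γ := γ + 2)
    (by exact_mod_cast hγ' 2) hz).mul_left (α * (γ - β) / (γ * (γ + 1)) * z)
  have key := s0.unique (((s1.add s2).sub s3).of_eq fun k => by
    rw [gaussCoeff_succ α β hγ k, pow_succ]; ring)
  simp [gaussCoeff, poch_zero] at key
  linear_combination key

theorem neg_natCast_shift {γ : ℂ} (hγ : ∀ n : ℕ, γ ≠ -(n : ℂ)) (m : ℕ) (n : ℕ) :
    γ + m ≠ -(n : ℂ) := fun h => hγ (m + n) (by push_cast; linear_combination h)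

/-- This is the nonvanishing set of the entire function `1 / Γ`. -/
theorem isOpen_ne_neg_natCast : IsOpen {γ : ℂ | ∀ n : ℕ, γ ≠ -(n : ℂ)} := by
  have : {γ : ℂ | ∀ n : ℕ, γ ≠ -(n : ℂ)} = {γ : ℂ | (Complex.Gamma γ)⁻¹ ≠ 0} := by
    ext γ
    simp [Complex.Gamma_eq_zero_iff]
  rw [this]
  exact isOpen_ne_fun Complex.differentiable_one_div_Gamma.continuous continuous_const

/-- The `(β, γ, z)` for which the analytic continuation of the Gauss series is defined. -/
def gaussDomain : Set (ℂ × ℂ × ℂ) := {p | (∀ n : ℕ, p.2.1 ≠ -(n : ℂ)) ∧ p.2.2 ∈ planeMinusOneInfty}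

theorem isOpen_gaussDomain : IsOpen gaussDomain := by
  have h1 : IsOpen {p : ℂ × ℂ × ℂ | p.2.1 ∈ {γ : ℂ | ∀ n : ℕ, γ ≠ -(n : ℂ)}} :=
    isOpen_ne_neg_natCast.preimage (by fun_prop)
  have h2 : IsOpen {p : ℂ × ℂ × ℂ | p.2.2 ∈ planeMinusOneInfty} :=
    isOpen_planeMinusOneInfty.preimage (by fun_prop)
  exact h1.inter h2

/-- The part of `gaussDomain` that `n` applications of the recurrence bring into the domain of
Euler's integral. -/
def gaussRegion (n : ℕ) : Set (ℂ × ℂ × ℂ) :=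
  {p | -(n : ℝ) < p.1.re ∧ -(n : ℝ) < (p.2.1 - p.1).re} ∩ gaussDomain

theorem isOpen_gaussRegion (n : ℕ) : IsOpen (gaussRegion n) := by
  have h1 : IsOpen {p : ℂ × ℂ × ℂ | -(n : ℝ) < p.1.re} := isOpen_lt (by fun_prop) (by fun_prop)
  have h2 : IsOpen {p : ℂ × ℂ × ℂ | -(n : ℝ) < (p.2.1 - p.1).re} :=
    isOpen_lt (by fun_prop) (by fun_prop)
  exact (h1.inter h2).inter isOpen_gaussDomain

theorem exists_mem_gaussRegion {p : ℂ × ℂ × ℂ} (hp : p ∈ gaussDomain) :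
    ∃ n, p ∈ gaussRegion n := by
  obtain ⟨n, hn⟩ := exists_nat_gt (max (-p.1.re) (-(p.2.1 - p.1).re))
  exact ⟨n, ⟨by linarith [(max_lt_iff.1 hn).1], by linarith [(max_lt_iff.1 hn).2]⟩, hp⟩

/-- Induction on the number of recurrence steps, starting from Euler's integral. The two claims go
together: agreement with the series at the shifted parameters is what lets the right-hand side of
the recurrence serve as a holomorphic extension of the original series. `α` is generalised because
the recurrence raises it. -/
theorem gaussHypergeometric_region (n : ℕ) (α : ℂ) :
    DifferentiableOn ℂ (fun p : ℂ × ℂ × ℂ => gaussHypergeometric α p.1 p.2.1 p.2.2)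
      (gaussRegion n) ∧
    ∀ p ∈ gaussRegion n, ‖p.2.2‖ < 1 →
      gaussHypergeometric α p.1 p.2.1 p.2.2 = ordinaryHypergeometric α p.1 p.2.1 p.2.2 := by
  induction n generalizing α with
  | zero =>
    have hsub : gaussRegion 0 ⊆ eulerDomain := fun p hp =>
      ⟨by simpa using hp.1.1, by simpa using hp.1.2, hp.2.2⟩
    constructor
    · have h : Set.EqOn (fun p : ℂ × ℂ × ℂ => gaussHypergeometric α p.1 p.2.1 p.2.2)
          (fun p => Complex.Gamma p.2.1 * ((Complex.Gamma p.1)⁻¹ *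
            (Complex.Gamma (p.2.1 - p.1))⁻¹) * eulerIntegral α p.1 p.2.1 p.2.2)
          (gaussRegion 0) := by
        intro p hp
        have hp' := hsub hp
        simp only
        rw [gaussHypergeometric_eq_eulerIntegral α hp'.1 hp'.2.1 hp'.2.2, div_eq_mul_inv, mul_inv]
      refine DifferentiableOn.congr ?_ h
      refine DifferentiableOn.mul ?_ ((differentiableOn_eulerIntegral α).mono hsub)
      intro p hp
      refine DifferentiableAt.differentiableWithinAt ?_
      refine DifferentiableAt.mul ?_ (DifferentiableAt.mul ?_ ?_)
      · exact (Complex.differentiableAt_Gamma _ hp.2.1).comp p (f := fun p : ℂ × ℂ × ℂ => p.2.1)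
          (by fun_prop)
      · exact (Complex.differentiable_one_div_Gamma _).comp p (f := fun p : ℂ × ℂ × ℂ => p.1)
          (by fun_prop)
      · exact (Complex.differentiable_one_div_Gamma _).comp p
          (f := fun p : ℂ × ℂ × ℂ => p.2.1 - p.1) (by fun_prop)
    · intro p hp hz
      have hp' := hsub hp
      have h2 := Complex.Gamma_ne_zero_of_re_pos hp'.1
      have h3 := Complex.Gamma_ne_zero_of_re_pos hp'.2.1
      have h4 := Complex.Gamma_ne_zero hp.2.1
      rw [gaussHypergeometric_eq_eulerIntegral α hp'.1 hp'.2.1 hp'.2.2,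
        eulerIntegral_eq_of_norm_lt_one α hp'.1 hp'.2.1 hz]
      field_simp
  | succ n ih =>
    have m1 : ∀ p ∈ gaussRegion (n + 1), (p.1 + 1, p.2.1 + 2, p.2.2) ∈ gaussRegion n := by
      rintro p ⟨⟨h1, h2⟩, h3, h4⟩
      push_cast at h1 h2
      simp only [Complex.sub_re] at h2
      refine ⟨⟨?_, ?_⟩, by exact_mod_cast neg_natCast_shift h3 2, h4⟩
      · simp only [Complex.add_re, Complex.one_re]; linarith
      · simp only [Complex.add_re, Complex.one_re, Complex.sub_re, Complex.re_ofNat]; linarith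
    have m2 : ∀ p ∈ gaussRegion (n + 1), (p.1 + 2, p.2.1 + 3, p.2.2) ∈ gaussRegion n := by
      rintro p ⟨⟨h1, h2⟩, h3, h4⟩
      push_cast at h1 h2
      simp only [Complex.sub_re] at h2
      refine ⟨⟨?_, ?_⟩, by exact_mod_cast neg_natCast_shift h3 3, h4⟩
      · simp only [Complex.add_re, Complex.re_ofNat]; linarith
      · simp only [Complex.add_re, Complex.sub_re, Complex.re_ofNat]; linarith
    let R : ℂ × ℂ × ℂ → ℂ := fun p => gaussHypergeometric α (p.1 + 1) (p.2.1 + 2) p.2.2 +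
      α * (p.1 + 1) / ((p.2.1 + 1) * (p.2.1 + 2)) * p.2.2 *
        gaussHypergeometric (α + 1) (p.1 + 2) (p.2.1 + 3) p.2.2 -
      α * (p.2.1 - p.1) / (p.2.1 * (p.2.1 + 1)) * p.2.2 *
        gaussHypergeometric (α + 1) (p.1 + 1) (p.2.1 + 2) p.2.2
    have hne : ∀ p ∈ gaussRegion (n + 1), p.2.1 ≠ 0 ∧ p.2.1 + 1 ≠ 0 ∧ p.2.1 + 2 ≠ 0 := by
      intro p hp
      have h0 := hp.2.1 0
      have h1 := neg_natCast_shift hp.2.1 1 0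
      have h2 := neg_natCast_shift hp.2.1 2 0
      simp only [Nat.cast_zero, neg_zero, Nat.cast_one, Nat.cast_ofNat] at h0 h1 h2
      exact ⟨h0, h1, h2⟩
    have hRd : DifferentiableOn ℂ R (gaussRegion (n + 1)) := by
      refine DifferentiableOn.sub (DifferentiableOn.add ?_ (DifferentiableOn.mul ?_ ?_))
        (DifferentiableOn.mul ?_ ?_)
      · exact (ih α).1.comp (f := fun p : ℂ × ℂ × ℂ => (p.1 + 1, p.2.1 + 2, p.2.2)) (by fun_prop) m1
      · refine DifferentiableOn.mul (DifferentiableOn.mul (by fun_prop) (DifferentiableOn.inv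
          (by fun_prop) fun p hp => mul_ne_zero (hne p hp).2.1 (hne p hp).2.2)) (by fun_prop)
      · exact (ih (α + 1)).1.comp (f := fun p : ℂ × ℂ × ℂ => (p.1 + 2, p.2.1 + 3, p.2.2))
          (by fun_prop) m2
      · refine DifferentiableOn.mul (DifferentiableOn.mul (by fun_prop) (DifferentiableOn.inv
          (by fun_prop) fun p hp => mul_ne_zero (hne p hp).1 (hne p hp).2.1)) (by fun_prop)
      · exact (ih (α + 1)).1.comp (f := fun p : ℂ × ℂ × ℂ => (p.1 + 1, p.2.1 + 2, p.2.2))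
          (by fun_prop) m1
    have hRs : ∀ p ∈ gaussRegion (n + 1), ‖p.2.2‖ < 1 →
        R p = ordinaryHypergeometric α p.1 p.2.1 p.2.2 := by
      intro p hp hz
      rw [ordinaryHypergeometric_recurrence α p.1 hp.2.1 hz, ← (ih α).2 _ (m1 p hp) hz,
        ← (ih (α + 1)).2 _ (m1 p hp) hz, ← (ih (α + 1)).2 _ (m2 p hp) hz]
    have hR : ∀ p ∈ gaussRegion (n + 1), gaussHypergeometric α p.1 p.2.1 p.2.2 = R p := by
      rintro ⟨β, γ, z⟩ hp
      refine gaussHypergeometric_eqOn (F := fun z => R (β, γ, z)) ?_ ?_ hp.2.2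
      · exact hRd.comp (f := fun z => (β, γ, z)) (by fun_prop) fun z hz => ⟨hp.1, hp.2.1, hz⟩
      · intro z hz
        have hz' : ‖z‖ < 1 := by simpa using hz
        exact hRs (β, γ, z) ⟨hp.1, hp.2.1, mem_planeMinusOneInfty_of_norm_lt_one hz'⟩ hz'
    exact ⟨hRd.congr hR, fun p hp hz => (hR p hp).trans (hRs p hp hz)⟩

theorem differentiableOn_gaussHypergeometric (α : ℂ) :
    DifferentiableOn ℂ (fun p : ℂ × ℂ × ℂ => gaussHypergeometric α p.1 p.2.1 p.2.2)
      gaussDomain := by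
  intro p hp
  obtain ⟨n, hn⟩ := exists_mem_gaussRegion hp
  exact (((gaussHypergeometric_region n α).1 p hn).differentiableAt
    ((isOpen_gaussRegion n).mem_nhds hn)).differentiableWithinAt

theorem gaussHypergeometric_eq_ordinaryHypergeometric (α β : ℂ) {γ z : ℂ}
    (hγ : ∀ n : ℕ, γ ≠ -(n : ℂ)) (hz : ‖z‖ < 1) :
    gaussHypergeometric α β γ z = ordinaryHypergeometric α β γ z := by
  have hmem : (β, γ, z) ∈ gaussDomain := ⟨hγ, mem_planeMinusOneInfty_of_norm_lt_one hz⟩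
  obtain ⟨n, hn⟩ := exists_mem_gaussRegion hmem
  exact (gaussHypergeometric_region n α).2 (β, γ, z) hn hz

theorem differentiableOn_gaussHypergeometric_right (α β : ℂ) {γ : ℂ} (hγ : ∀ n : ℕ, γ ≠ -(n : ℂ)) :
    DifferentiableOn ℂ (gaussHypergeometric α β γ) planeMinusOneInfty :=
  (differentiableOn_gaussHypergeometric α).comp (f := fun z => (β, γ, z)) (by fun_prop)
    fun _ hz => ⟨hγ, hz⟩

theorem gaussHypergeometric_recurrence (α β : ℂ) {γ z : ℂ} (hγ : ∀ n : ℕ, γ ≠ -(n : ℂ))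
    (hz : z ∈ planeMinusOneInfty) :
    gaussHypergeometric α β γ z = gaussHypergeometric α (β + 1) (γ + 2) z +
      α * (β + 1) / ((γ + 1) * (γ + 2)) * z * gaussHypergeometric (α + 1) (β + 2) (γ + 3) z -
      α * (γ - β) / (γ * (γ + 1)) * z * gaussHypergeometric (α + 1) (β + 1) (γ + 2) z := by
  have h2 : ∀ n : ℕ, γ + 2 ≠ -(n : ℂ) := by exact_mod_cast neg_natCast_shift hγ 2
  have h3 : ∀ n : ℕ, γ + 3 ≠ -(n : ℂ) := by exact_mod_cast neg_natCast_shift hγ 3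
  have d1 := differentiableOn_gaussHypergeometric_right α (β + 1) h2
  have d2 := differentiableOn_gaussHypergeometric_right (α + 1) (β + 2) h3
  have d3 := differentiableOn_gaussHypergeometric_right (α + 1) (β + 1) h2
  refine gaussHypergeometric_eqOn (F := fun z => gaussHypergeometric α (β + 1) (γ + 2) z +
      α * (β + 1) / ((γ + 1) * (γ + 2)) * z * gaussHypergeometric (α + 1) (β + 2) (γ + 3) z -
      α * (γ - β) / (γ * (γ + 1)) * z * gaussHypergeometric (α + 1) (β + 1) (γ + 2) z)
    (by fun_prop) (fun z hz => ?_) hz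
  have hz' : ‖z‖ < 1 := by simpa using hz
  simp only
  rw [ordinaryHypergeometric_recurrence α β hγ hz',
    gaussHypergeometric_eq_ordinaryHypergeometric _ _ h2 hz',
    gaussHypergeometric_eq_ordinaryHypergeometric _ _ h2 hz',
    gaussHypergeometric_eq_ordinaryHypergeometric _ _ h3 hz']

/-! ### Growth of the Gauss function along rays -/

theorem ofReal_mul_cpow {r : ℝ} (hr : 0 < r) {w : ℂ} (hw : w ≠ 0) (s : ℂ) :
    ((r : ℂ) * w) ^ s = (r : ℂ) ^ s * w ^ s := by
  have hr' : (r : ℂ) ≠ 0 := Complex.ofReal_ne_zero.2 hr.ne'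
  rw [Complex.cpow_def_of_ne_zero (mul_ne_zero hr' hw), Complex.cpow_def_of_ne_zero hr',
    Complex.cpow_def_of_ne_zero hw, Complex.log_ofReal_mul hr hw, add_mul, Complex.exp_add,
    Complex.ofReal_log hr.le]

theorem inv_mem_slitPlane {y : ℂ} (hy : y ∈ Complex.slitPlane) : y⁻¹ ∈ Complex.slitPlane := by
  have h0 := Complex.normSq_pos.2 (Complex.slitPlane_ne_zero hy)
  rw [Complex.mem_slitPlane_iff] at hy ⊢
  rw [Complex.inv_re, Complex.inv_im]
  rcases hy with h | h
  · exact Or.inl (div_pos h h0)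
  · exact Or.inr (div_ne_zero (neg_ne_zero.2 h) h0.ne')

theorem one_add_div_mem_slitPlane {y : ℂ} (hy : y ∈ Complex.slitPlane) {v : ℝ} (hv : 0 ≤ v) :
    1 + (v : ℂ) / y ∈ Complex.slitPlane := by
  have h := inv_mem_slitPlane hy
  rw [Complex.mem_slitPlane_iff] at h ⊢
  rw [div_eq_mul_inv, Complex.add_re, Complex.add_im, Complex.re_ofReal_mul, Complex.im_ofReal_mul,
    Complex.one_re, Complex.one_im, zero_add]
  rcases hv.eq_or_lt with rfl | hv
  · simp
  · rcases h with h | h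
    · left; positivity
    · exact Or.inr (mul_ne_zero hv.ne' h)

theorem neg_div_mem_planeMinusOneInfty {y : ℂ} (hy : y ∈ Complex.slitPlane) {v : ℝ} (hv : 0 ≤ v) :
    -((v : ℂ) / y) ∈ planeMinusOneInfty := by
  rw [mem_planeMinusOneInfty_iff, sub_neg_eq_add]
  exact one_add_div_mem_slitPlane hy hv

theorem exists_norm_one_add_div_cpow_le (α : ℂ) {y₀ : ℂ} (hy₀ : y₀ ∈ Complex.slitPlane) :
    ∃ C > 0, ∀ᶠ y in 𝓝 y₀, ∀ w : ℝ, 0 ≤ w → ‖(1 + (w : ℂ) / y) ^ (-α)‖ ≤ C * (1 + w) ^ (-α.re) := by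
  have hz₀ : 1 - y₀⁻¹ ∈ planeMinusOneInfty := by
    rw [mem_planeMinusOneInfty_iff, sub_sub_cancel]
    exact inv_mem_slitPlane hy₀
  obtain ⟨C, hC0, hC⟩ := exists_norm_one_sub_mul_cpow_le α hz₀
  refine ⟨C, hC0, ?_⟩
  have hcont : Tendsto (fun y : ℂ => 1 - y⁻¹) (𝓝 y₀) (𝓝 (1 - y₀⁻¹)) :=
    tendsto_const_nhds.sub (tendsto_inv₀ (Complex.slitPlane_ne_zero hy₀))
  filter_upwards [hcont.eventually hC, Complex.isOpen_slitPlane.mem_nhds hy₀] with y hy hys w hw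
  have hw1 : 0 < 1 + w := by linarith
  have hθ : w / (1 + w) ∈ Set.Icc (0 : ℝ) 1 :=
    ⟨by positivity, (div_le_one hw1).2 (by linarith)⟩
  have hw1' : (1 + (w : ℂ)) ≠ 0 := by exact_mod_cast hw1.ne'
  have hy0 := Complex.slitPlane_ne_zero hys
  -- With `θ = w / (1 + w)` the half-line `w ≥ 0` is mapped into `[0, 1]`; the growth sits in the
  -- positive factor `1 + w` and the other factor is bounded by compactness.
  have e : 1 + (w : ℂ) / y = ((1 + w : ℝ) : ℂ) * (1 - (1 - y⁻¹) * ((w / (1 + w) : ℝ) : ℂ)) := by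
    push_cast
    field_simp
    ring
  have hne : 1 - (1 - y⁻¹) * ((w / (1 + w) : ℝ) : ℂ) ≠ 0 := by
    intro h
    rw [h, mul_zero] at e
    exact Complex.slitPlane_ne_zero (one_add_div_mem_slitPlane hys hw) e
  rw [e, ofReal_mul_cpow hw1 hne, norm_mul, Complex.norm_cpow_eq_rpow_re_of_pos hw1, mul_comm,
    Complex.neg_re]
  gcongr
  exact hy _ hθ

/-- For `s ≤ 0` use `1 + v t ≤ 1 + v`; for `s > 0` use `t (1 + v) ≤ 1 + v t`, at the price of `t ^
(-s)`. -/
theorem one_add_mul_rpow_neg_le {r s t v : ℝ} (hsr : s ≤ r) (ht : t ∈ Set.Ioo (0 : ℝ) 1)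
    (hv : 0 ≤ v) : (1 + v * t) ^ (-r) ≤ t ^ (-max s 0) * (1 + v) ^ (-s) := by
  have hvt : 0 ≤ v * t := mul_nonneg hv ht.1.le
  refine (Real.rpow_le_rpow_of_exponent_le (by linarith) (neg_le_neg hsr)).trans ?_
  rcases le_or_gt s 0 with hs | hs
  · rw [max_eq_right hs, neg_zero, Real.rpow_zero, one_mul]
    refine Real.rpow_le_rpow (by linarith) ?_ (by linarith)
    nlinarith [ht.2]
  · rw [max_eq_left hs.le, ← Real.mul_rpow ht.1.le (by linarith)]
    refine Real.rpow_le_rpow_of_nonpos (mul_pos ht.1 (by linarith)) ?_ (by linarith)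
    nlinarith [ht.2]

theorem exists_norm_gaussHypergeometric_le_of_euler (α : ℂ) {β₀ γ₀ y₀ : ℂ} {s : ℝ}
    (hβ : 0 < β₀.re) (hγβ : 0 < (γ₀ - β₀).re) (hy : y₀ ∈ Complex.slitPlane) (hsα : s < α.re)
    (hsβ : s < β₀.re) :
    ∃ C ≥ 0, ∀ᶠ p : ℂ × ℂ × ℂ in 𝓝 (β₀, γ₀, y₀), ∀ v : ℝ, 0 ≤ v →
      ‖gaussHypergeometric α p.1 p.2.1 (-((v : ℂ) / p.2.2))‖ ≤ C * (1 + v) ^ (-s) := by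
  have hγ : 0 < γ₀.re := by rw [Complex.sub_re] at hγβ; linarith
  -- The weight `t ^ (b - 1)` has to absorb the loss `t ^ (-max s 0)` and stay integrable, uniformly
  -- for parameters near `β₀`; hence `max s 0 < b < Re β₀`.
  obtain ⟨b, hb1, hb2⟩ := exists_between (max_lt hsβ hβ)
  obtain ⟨C, hC0, hC⟩ := exists_norm_one_add_div_cpow_le α hy
  have hpref : ContinuousAt (fun p : ℂ × ℂ × ℂ => ‖Complex.Gamma p.2.1 /
      (Complex.Gamma p.1 * Complex.Gamma (p.2.1 - p.1))‖) (β₀, γ₀, y₀) := by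
    have g1 := (Complex.differentiableAt_Gamma _ (ne_neg_natCast_of_re_pos hγ)).continuousAt
    have g2 := (Complex.differentiableAt_Gamma _ (ne_neg_natCast_of_re_pos hβ)).continuousAt
    have g3 := (Complex.differentiableAt_Gamma _ (ne_neg_natCast_of_re_pos hγβ)).continuousAt
    refine ((ContinuousAt.comp (f := fun p : ℂ × ℂ × ℂ => p.2.1) g1 (by fun_prop)).div
      ((ContinuousAt.comp (f := fun p : ℂ × ℂ × ℂ => p.1) g2 (by fun_prop)).mul
      (ContinuousAt.comp (f := fun p : ℂ × ℂ × ℂ => p.2.1 - p.1) g3 (by fun_prop)))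
      (mul_ne_zero (Complex.Gamma_ne_zero_of_re_pos hβ) (Complex.Gamma_ne_zero_of_re_pos hγβ))).norm
  obtain ⟨M, hM⟩ := exists_gt (‖Complex.Gamma γ₀ /
      (Complex.Gamma β₀ * Complex.Gamma (γ₀ - β₀))‖)
  have hM0 : 0 ≤ M := (norm_nonneg _).trans hM.le
  have e0 : ∀ᶠ p : ℂ × ℂ × ℂ in 𝓝 (β₀, γ₀, y₀), ‖Complex.Gamma p.2.1 /
      (Complex.Gamma p.1 * Complex.Gamma (p.2.1 - p.1))‖ < M :=
    Tendsto.eventually hpref (gt_mem_nhds hM)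
  have e1 : ∀ᶠ p : ℂ × ℂ × ℂ in 𝓝 (β₀, γ₀, y₀), b < p.1.re :=
    (isOpen_lt (by fun_prop) (by fun_prop)).mem_nhds hb2
  have e2 : ∀ᶠ p : ℂ × ℂ × ℂ in 𝓝 (β₀, γ₀, y₀), (γ₀ - β₀).re / 2 < (p.2.1 - p.1).re :=
    (isOpen_lt (by fun_prop) (by fun_prop)).mem_nhds (half_lt_self hγβ)
  have e3 : Tendsto (fun p : ℂ × ℂ × ℂ => p.2.2) (𝓝 (β₀, γ₀, y₀)) (𝓝 y₀) :=
    Continuous.tendsto' (by fun_prop) _ _ rfl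
  have hbm : 0 < b - max s 0 := sub_pos.2 hb1
  have hb0 : 0 < b := (le_max_right _ _).trans_lt hb1
  have hint := integrableOn_rpow_mul_rpow hbm (half_pos hγβ)
  set B := ∫ t in Set.Ioo (0 : ℝ) 1, t ^ (b - max s 0 - 1) * (1 - t) ^ ((γ₀ - β₀).re / 2 - 1)
    with hB
  have hB0 : 0 ≤ B := setIntegral_nonneg measurableSet_Ioo fun t ht =>
    mul_nonneg (Real.rpow_nonneg ht.1.le _) (Real.rpow_nonneg (sub_nonneg.2 ht.2.le) _)
  refine ⟨M * (B * C), by positivity, ?_⟩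
  filter_upwards [e0, e1, e2, e3.eventually hC,
    e3.eventually (Complex.isOpen_slitPlane.mem_nhds hy)] with p h0 h1 h2 h3 h4 v hv
  have hpβ : 0 < p.1.re := hb0.trans h1
  have hpγ : 0 < (p.2.1 - p.1).re := (half_pos hγβ).trans h2
  rw [gaussHypergeometric_eq_eulerIntegral α hpβ hpγ (neg_div_mem_planeMinusOneInfty h4 hv),
    norm_mul, mul_assoc]
  refine mul_le_mul h0.le ?_ (norm_nonneg _) hM0
  rw [mul_assoc, hB, ← integral_mul_const]
  refine norm_integral_le_of_norm_le (hint.mul_const _)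
    ((ae_restrict_iff' measurableSet_Ioo).2 (Eventually.of_forall fun t ht => ?_))
  have h5 : ‖(1 - -((v : ℂ) / p.2.2) * (t : ℂ)) ^ (-α)‖ ≤
      C * (t ^ (-max s 0) * (1 + v) ^ (-s)) := by
    have : 1 - -((v : ℂ) / p.2.2) * (t : ℂ) = 1 + ((v * t : ℝ) : ℂ) / p.2.2 := by push_cast; ring
    rw [this]
    refine (h3 _ (mul_nonneg hv ht.1.le)).trans ?_
    gcongr
    exact one_add_mul_rpow_neg_le hsα.le ht hv
  have h1t : 0 ≤ 1 - t := sub_nonneg.2 ht.2.le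
  have ht0 : 0 ≤ t := ht.1.le
  calc _ ≤ (t ^ (b - 1) * (1 - t) ^ ((γ₀ - β₀).re / 2 - 1)) *
        (C * (t ^ (-max s 0) * (1 + v) ^ (-s))) := by
        rw [norm_mul]
        exact mul_le_mul (norm_ofReal_cpow_mul_le h1.le h2.le ht) h5 (norm_nonneg _) (by positivity)
    _ = _ := by
        rw [show b - max s 0 - 1 = (b - 1) + (-max s 0) by ring, Real.rpow_add ht.1]
        ring

/-- Induction along the recurrence. In the terms with the factor `z = -v / y`, both `α` and `β` have
grown by at least `1`, so the induction hypothesis holds with `s + 1`, and `v * (1 + v) ^ (-(s + 1))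
≤ (1 + v) ^ (-s)` restores the exponent. -/
theorem exists_norm_gaussHypergeometric_le_aux (n : ℕ) (α : ℂ) {β₀ γ₀ y₀ : ℂ} {s : ℝ}
    (hβ : -(n : ℝ) < β₀.re) (hγβ : -(n : ℝ) < (γ₀ - β₀).re) (hγ : ∀ m : ℕ, γ₀ ≠ -(m : ℂ))
    (hy : y₀ ∈ Complex.slitPlane) (hsα : s < α.re) (hsβ : s < β₀.re) :
    ∃ C ≥ 0, ∀ᶠ p : ℂ × ℂ × ℂ in 𝓝 (β₀, γ₀, y₀), ∀ v : ℝ, 0 ≤ v →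
      ‖gaussHypergeometric α p.1 p.2.1 (-((v : ℂ) / p.2.2))‖ ≤ C * (1 + v) ^ (-s) := by
  induction n generalizing α β₀ γ₀ s with
  | zero =>
    exact exists_norm_gaussHypergeometric_le_of_euler α (by simpa using hβ)
      (by simpa using hγβ) hy hsα hsβ
  | succ n ih =>
    push_cast at hβ hγβ
    rw [Complex.sub_re] at hγβ
    have g2 : ∀ m : ℕ, γ₀ + 2 ≠ -(m : ℂ) := by exact_mod_cast neg_natCast_shift hγ 2
    have g3 : ∀ m : ℕ, γ₀ + 3 ≠ -(m : ℂ) := by exact_mod_cast neg_natCast_shift hγ 3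
    obtain ⟨C₁, hC₁, h₁⟩ := ih α (β₀ := β₀ + 1) (γ₀ := γ₀ + 2) (s := s)
      (by simp; linarith) (by simp; linarith) g2 hsα (by simp; linarith)
    obtain ⟨C₂, hC₂, h₂⟩ := ih (α + 1) (β₀ := β₀ + 2) (γ₀ := γ₀ + 3) (s := s + 1)
      (by simp; linarith) (by simp; linarith) g3 (by simpa) (by simp; linarith)
    obtain ⟨C₃, hC₃, h₃⟩ := ih (α + 1) (β₀ := β₀ + 1) (γ₀ := γ₀ + 2) (s := s + 1)
      (by simp; linarith) (by simp; linarith) g2 (by simpa) (by simpa)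
    have hy0 := Complex.slitPlane_ne_zero hy
    have q0 : γ₀ ≠ 0 := by simpa using hγ 0
    have q1 : γ₀ + 1 ≠ 0 := by simpa using neg_natCast_shift hγ 1 0
    have q2 : γ₀ + 2 ≠ 0 := by simpa using neg_natCast_shift hγ 2 0
    have cA : ContinuousAt (fun p : ℂ × ℂ × ℂ =>
        ‖α * (p.1 + 1) / ((p.2.1 + 1) * (p.2.1 + 2)) * p.2.2⁻¹‖) (β₀, γ₀, y₀) := by
      refine ContinuousAt.norm (ContinuousAt.mul (ContinuousAt.div ?_ ?_ ?_)
        (ContinuousAt.inv₀ ?_ ?_))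
      · fun_prop
      · fun_prop
      · exact mul_ne_zero q1 q2
      · fun_prop
      · exact hy0
    have cB : ContinuousAt (fun p : ℂ × ℂ × ℂ =>
        ‖α * (p.2.1 - p.1) / (p.2.1 * (p.2.1 + 1)) * p.2.2⁻¹‖) (β₀, γ₀, y₀) := by
      refine ContinuousAt.norm (ContinuousAt.mul (ContinuousAt.div ?_ ?_ ?_)
        (ContinuousAt.inv₀ ?_ ?_))
      · fun_prop
      · fun_prop
      · exact mul_ne_zero q0 q1
      · fun_prop
      · exact hy0
    obtain ⟨MA, hMA⟩ := exists_gt ‖α * (β₀ + 1) / ((γ₀ + 1) * (γ₀ + 2)) * y₀⁻¹‖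
    obtain ⟨MB, hMB⟩ := exists_gt ‖α * (γ₀ - β₀) / (γ₀ * (γ₀ + 1)) * y₀⁻¹‖
    have hMA0 : 0 ≤ MA := (norm_nonneg _).trans hMA.le
    have hMB0 : 0 ≤ MB := (norm_nonneg _).trans hMB.le
    have t1 : Tendsto (fun p : ℂ × ℂ × ℂ => (p.1 + 1, p.2.1 + 2, p.2.2)) (𝓝 (β₀, γ₀, y₀))
      (𝓝 (β₀ + 1, γ₀ + 2, y₀)) := Continuous.tendsto' (by fun_prop) _ _ rfl
    have t2 : Tendsto (fun p : ℂ × ℂ × ℂ => (p.1 + 2, p.2.1 + 3, p.2.2)) (𝓝 (β₀, γ₀, y₀))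
      (𝓝 (β₀ + 2, γ₀ + 3, y₀)) := Continuous.tendsto' (by fun_prop) _ _ rfl
    have t3 : Tendsto (fun p : ℂ × ℂ × ℂ => p.2.2) (𝓝 (β₀, γ₀, y₀)) (𝓝 y₀) :=
      Continuous.tendsto' (by fun_prop) _ _ rfl
    have t4 : Tendsto (fun p : ℂ × ℂ × ℂ => p.2.1) (𝓝 (β₀, γ₀, y₀)) (𝓝 γ₀) :=
      Continuous.tendsto' (by fun_prop) _ _ rfl
    refine ⟨C₁ + MA * C₂ + MB * C₃, by positivity, ?_⟩
    filter_upwards [t1.eventually h₁, t2.eventually h₂, t1.eventually h₃,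
      Tendsto.eventually cA (gt_mem_nhds hMA), Tendsto.eventually cB (gt_mem_nhds hMB),
      t3.eventually (Complex.isOpen_slitPlane.mem_nhds hy),
      t4.eventually (isOpen_ne_neg_natCast.mem_nhds hγ)] with p k1 k2 k3 kA kB ky kγ v hv
    rw [gaussHypergeometric_recurrence α p.1 kγ (neg_div_mem_planeMinusOneInfty ky hv)]
    have hv1 : 0 < 1 + v := by linarith
    have hpow : v * (1 + v) ^ (-(s + 1)) ≤ (1 + v) ^ (-s) := by
      rw [show -s = 1 + -(s + 1) by ring, Real.rpow_add hv1, Real.rpow_one]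
      gcongr
      linarith
    have nv : ∀ w : ℂ, ‖w * -((v : ℂ) / p.2.2)‖ = ‖w * p.2.2⁻¹‖ * v := by
      intro w
      rw [div_eq_mul_inv, ← neg_mul, mul_comm (-(v : ℂ)), ← mul_assoc, norm_mul _ (-(v : ℂ)),
        norm_neg, Complex.norm_of_nonneg hv]
    have b1 := k1 v hv
    have b2 : ‖α * (p.1 + 1) / ((p.2.1 + 1) * (p.2.1 + 2)) * -((v : ℂ) / p.2.2) *
        gaussHypergeometric (α + 1) (p.1 + 2) (p.2.1 + 3) (-((v : ℂ) / p.2.2))‖ ≤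
        MA * C₂ * (1 + v) ^ (-s) := by
      rw [norm_mul, nv]
      calc _ ≤ MA * v * (C₂ * (1 + v) ^ (-(s + 1))) := by
            gcongr
            exact k2 v hv
        _ = MA * C₂ * (v * (1 + v) ^ (-(s + 1))) := by ring
        _ ≤ _ := by gcongr
    have b3 : ‖α * (p.2.1 - p.1) / (p.2.1 * (p.2.1 + 1)) * -((v : ℂ) / p.2.2) *
        gaussHypergeometric (α + 1) (p.1 + 1) (p.2.1 + 2) (-((v : ℂ) / p.2.2))‖ ≤
        MB * C₃ * (1 + v) ^ (-s) := by
      rw [norm_mul, nv]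
      calc _ ≤ MB * v * (C₃ * (1 + v) ^ (-(s + 1))) := by
            gcongr
            exact k3 v hv
        _ = MB * C₃ * (v * (1 + v) ^ (-(s + 1))) := by ring
        _ ≤ _ := by gcongr
    refine (norm_sub_le _ _).trans ((add_le_add_left (norm_add_le _ _) _).trans ?_)
    linarith

/-- Growth of the Gauss hypergeometric function along rays, locally uniform in the parameters. -/
theorem exists_norm_gaussHypergeometric_le (α : ℂ) {β₀ γ₀ y₀ : ℂ} {s : ℝ}
    (hγ : ∀ m : ℕ, γ₀ ≠ -(m : ℂ)) (hy : y₀ ∈ Complex.slitPlane) (hsα : s < α.re)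
    (hsβ : s < β₀.re) :
    ∃ C ≥ 0, ∀ᶠ p : ℂ × ℂ × ℂ in 𝓝 (β₀, γ₀, y₀), ∀ v : ℝ, 0 ≤ v →
      ‖gaussHypergeometric α p.1 p.2.1 (-((v : ℂ) / p.2.2))‖ ≤ C * (1 + v) ^ (-s) := by
  obtain ⟨n, hn⟩ := exists_nat_gt (max (-β₀.re) (-(γ₀ - β₀).re))
  exact exists_norm_gaussHypergeometric_le_aux n α (by linarith [(max_lt_iff.1 hn).1])
    (by linarith [(max_lt_iff.1 hn).2]) hγ hy hsα hsβ

/-! ### Convergence and holomorphy of the integral for `F_P` -/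

/-- The integrand of the representation of `F_P`, in terms of the parameters of its
hypergeometric factor. -/
noncomputable def fpIntegrand (a b α β γ x y : ℂ) (u : ℝ) : ℂ :=
  (u : ℂ) ^ (a - α - 1) * (1 - (u : ℂ)) ^ (γ - 1) * (1 - x * (u : ℂ)) ^ (-b) *
    gaussHypergeometric α β γ (y⁻¹ * (1 - (u : ℂ)⁻¹))

/-- The region of the `(β, γ, x, y)` for which `fpIntegrand` is integrable. -/
def fpDomain (a α : ℂ) : Set (ℂ × ℂ × ℂ × ℂ) :=
  {p | (α - a).re < p.1.re ∧ 0 < p.2.1.re ∧ p.2.2.1 ∈ planeMinusOneInfty ∧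
    p.2.2.2 ∈ Complex.slitPlane}

theorem isOpen_fpDomain (a α : ℂ) : IsOpen (fpDomain a α) := by
  have h1 : IsOpen {p : ℂ × ℂ × ℂ × ℂ | (α - a).re < p.1.re} :=
    isOpen_lt (by fun_prop) (by fun_prop)
  have h2 : IsOpen {p : ℂ × ℂ × ℂ × ℂ | 0 < p.2.1.re} := isOpen_lt (by fun_prop) (by fun_prop)
  have h3 : IsOpen {p : ℂ × ℂ × ℂ × ℂ | p.2.2.1 ∈ planeMinusOneInfty} :=
    isOpen_planeMinusOneInfty.preimage (by fun_prop)
  have h4 : IsOpen {p : ℂ × ℂ × ℂ × ℂ | p.2.2.2 ∈ Complex.slitPlane} :=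
    Complex.isOpen_slitPlane.preimage (by fun_prop)
  exact h1.inter (h2.inter (h3.inter h4))

theorem inv_mul_one_sub_inv {y : ℂ} {u : ℝ} (hu : u ∈ Set.Ioo (0 : ℝ) 1) :
    y⁻¹ * (1 - (u : ℂ)⁻¹) = -((((1 - u) / u : ℝ) : ℂ) / y) := by
  have : (u : ℂ) ≠ 0 := Complex.ofReal_ne_zero.2 hu.1.ne'
  push_cast
  field_simp
  ring

theorem inv_mul_one_sub_inv_mem {y : ℂ} (hy : y ∈ Complex.slitPlane) {u : ℝ}
    (hu : u ∈ Set.Ioo (0 : ℝ) 1) : y⁻¹ * (1 - (u : ℂ)⁻¹) ∈ planeMinusOneInfty := by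
  rw [inv_mul_one_sub_inv hu]
  exact neg_div_mem_planeMinusOneInfty hy (div_nonneg (sub_nonneg.2 hu.2.le) hu.1.le)

theorem continuousOn_fpIntegrand (a b α : ℂ) {p : ℂ × ℂ × ℂ × ℂ} (hp : p ∈ fpDomain a α) :
    ContinuousOn (fpIntegrand a b α p.1 p.2.1 p.2.2.1 p.2.2.2) (Set.Ioo 0 1) := by
  intro u hu
  obtain ⟨-, hγ, hx, hy⟩ := hp
  have h1 := ofReal_mem_Ioo_slitPlane hu
  have h2 := one_sub_mul_mem_slitPlane hx (Set.Ioo_subset_Icc_self hu)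
  have h3 := inv_mul_one_sub_inv_mem hy hu
  have h4 := ((differentiableOn_gaussHypergeometric_right α p.1
    (ne_neg_natCast_of_re_pos hγ)).differentiableAt
    (isOpen_planeMinusOneInfty.mem_nhds h3)).continuousAt
  refine ContinuousAt.continuousWithinAt ?_
  refine (((ContinuousAt.cpow (by fun_prop) (by fun_prop) h1.1).mul
    (ContinuousAt.cpow (by fun_prop) (by fun_prop) h1.2)).mul
    (ContinuousAt.cpow (by fun_prop) (by fun_prop) h2)).mul
    (ContinuousAt.comp (f := fun u : ℝ => p.2.2.2⁻¹ * (1 - (u : ℂ)⁻¹)) h4 ?_)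
  exact continuousAt_const.mul (continuousAt_const.sub
    (Complex.continuous_ofReal.continuousAt.inv₀ (Complex.slitPlane_ne_zero h1.1)))

theorem differentiableOn_fpIntegrand (a b α : ℂ) {u : ℝ} (hu : u ∈ Set.Ioo (0 : ℝ) 1) :
    DifferentiableOn ℂ (fun p : ℂ × ℂ × ℂ × ℂ =>
      fpIntegrand a b α p.1 p.2.1 p.2.2.1 p.2.2.2 u) (fpDomain a α) := by
  rintro p ⟨-, hγ, hx, hy⟩
  have h1 := ofReal_mem_Ioo_slitPlane hu
  have h2 := one_sub_mul_mem_slitPlane hx (Set.Ioo_subset_Icc_self hu)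
  have h3 := inv_mul_one_sub_inv_mem hy hu
  have h4 : (p.1, p.2.1, p.2.2.2⁻¹ * (1 - (u : ℂ)⁻¹)) ∈ gaussDomain :=
    ⟨ne_neg_natCast_of_re_pos hγ, h3⟩
  have h5 := (differentiableOn_gaussHypergeometric α).differentiableAt
    (isOpen_gaussDomain.mem_nhds h4)
  refine DifferentiableAt.differentiableWithinAt ?_
  unfold fpIntegrand
  refine DifferentiableAt.mul (DifferentiableAt.mul (DifferentiableAt.mul (by fun_prop) ?_) ?_) ?_
  · exact DifferentiableAt.const_cpow (by fun_prop) (Or.inl (Complex.slitPlane_ne_zero h1.2))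
  · exact DifferentiableAt.cpow_const (by fun_prop) h2
  · refine DifferentiableAt.comp (f := fun p : ℂ × ℂ × ℂ × ℂ =>
      (p.1, p.2.1, p.2.2.2⁻¹ * (1 - (u : ℂ)⁻¹))) p h5 ?_
    refine DifferentiableAt.prodMk (by fun_prop) (DifferentiableAt.prodMk (by fun_prop)
      (DifferentiableAt.mul_const ((differentiableAt_inv (Complex.slitPlane_ne_zero hy)).comp p
        (f := fun p : ℂ × ℂ × ℂ × ℂ => p.2.2.2) (by fun_prop)) _))

/-- For `v = (1 - u) / u` one has `1 + v = 1 / u`, so the growth bound becomes `C * u ^ s`. Near `u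
= 0` the integrand is thus `O(u ^ (Re (a - α) + s - 1))`, integrable when `s > Re (α - a)`. Such an
`s` below `Re α` exists because `Re a > 0`, and below `Re β` by the first condition in `fpDomain`.
At `u = 1` the condition is `Re γ > 0`. -/
theorem exists_norm_fpIntegrand_le {a α : ℂ} (ha : 0 < a.re) (b : ℂ) {p₀ : ℂ × ℂ × ℂ × ℂ}
    (hp₀ : p₀ ∈ fpDomain a α) :
    ∃ g : ℝ → ℝ, IntegrableOn g (Set.Ioo 0 1) ∧ ∀ᶠ p : ℂ × ℂ × ℂ × ℂ in 𝓝 p₀,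
      ∀ u ∈ Set.Ioo (0 : ℝ) 1, ‖fpIntegrand a b α p.1 p.2.1 p.2.2.1 p.2.2.2 u‖ ≤ g u := by
  obtain ⟨hβ, hγ, hx, hy⟩ := hp₀
  have hm : (α - a).re < min α.re p₀.1.re := lt_min (by simpa using ha) hβ
  obtain ⟨s, hs1, hs2⟩ := exists_between hm
  obtain ⟨C, hC0, hC⟩ := exists_norm_gaussHypergeometric_le α (ne_neg_natCast_of_re_pos hγ) hy
    (hs2.trans_le (min_le_left _ _)) (hs2.trans_le (min_le_right _ _))
  obtain ⟨D, hD0, hD⟩ := exists_norm_one_sub_mul_cpow_le b hx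
  have he : 0 < (a - α).re + s := by
    simp only [Complex.sub_re] at hs1 ⊢
    linarith
  refine ⟨fun u => u ^ ((a - α).re + s - 1) * (1 - u) ^ (p₀.2.1.re / 2 - 1) * (D * C),
    (integrableOn_rpow_mul_rpow he (half_pos hγ)).mul_const _, ?_⟩
  have e1 : Tendsto (fun p : ℂ × ℂ × ℂ × ℂ => (p.1, p.2.1, p.2.2.2)) (𝓝 p₀)
      (𝓝 (p₀.1, p₀.2.1, p₀.2.2.2)) := Continuous.tendsto' (by fun_prop) _ _ rfl
  have e2 : Tendsto (fun p : ℂ × ℂ × ℂ × ℂ => p.2.2.1) (𝓝 p₀) (𝓝 p₀.2.2.1) :=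
    Continuous.tendsto' (by fun_prop) _ _ rfl
  have e3 : ∀ᶠ p : ℂ × ℂ × ℂ × ℂ in 𝓝 p₀, p₀.2.1.re / 2 < p.2.1.re :=
    (isOpen_lt (by fun_prop) (by fun_prop)).mem_nhds (half_lt_self hγ)
  filter_upwards [e1.eventually hC, e2.eventually hD, e3] with p h1 h2 h3 u hu
  have h1u : 0 ≤ 1 - u := sub_nonneg.2 hu.2.le
  have hu0 : 0 ≤ u := hu.1.le
  have hG : ‖gaussHypergeometric α p.1 p.2.1 (p.2.2.2⁻¹ * (1 - (u : ℂ)⁻¹))‖ ≤ C * u ^ s := by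
    rw [inv_mul_one_sub_inv hu]
    refine (h1 _ (div_nonneg h1u hu0)).trans_eq ?_
    have : 1 + (1 - u) / u = u⁻¹ := by field_simp [hu.1.ne']; ring
    rw [this, Real.inv_rpow hu0, Real.rpow_neg hu0, inv_inv]
  rw [fpIntegrand]
  calc _ ≤ (u ^ ((a - α).re - 1) * (1 - u) ^ (p₀.2.1.re / 2 - 1)) * D * (C * u ^ s) := by
        rw [norm_mul, norm_mul]
        refine mul_le_mul (mul_le_mul (norm_ofReal_cpow_mul_le le_rfl h3.le hu)
          (h2 u (Set.Ioo_subset_Icc_self hu)) (norm_nonneg _) (by positivity)) hG (norm_nonneg _)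
          (by positivity)
    _ = _ := by
        rw [show (a - α).re + s - 1 = ((a - α).re - 1) + s by ring, Real.rpow_add hu.1]
        ring

theorem integrableOn_fpIntegrand {a α : ℂ} (ha : 0 < a.re) (b : ℂ) {p : ℂ × ℂ × ℂ × ℂ}
    (hp : p ∈ fpDomain a α) :
    IntegrableOn (fpIntegrand a b α p.1 p.2.1 p.2.2.1 p.2.2.2) (Set.Ioo 0 1) := by
  obtain ⟨g, hg, h⟩ := exists_norm_fpIntegrand_le ha b hp
  exact Integrable.mono' hg
    ((continuousOn_fpIntegrand a b α hp).aestronglyMeasurable measurableSet_Ioo)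
    ((ae_restrict_iff' measurableSet_Ioo).2 (Eventually.of_forall h.self_of_nhds))

/-- The integral of `fpIntegrand`. -/
noncomputable def fpIntegral (a b α β γ x y : ℂ) : ℂ :=
  ∫ u in Set.Ioo (0 : ℝ) 1, fpIntegrand a b α β γ x y u

theorem differentiableOn_fpIntegral {a α : ℂ} (ha : 0 < a.re) (b : ℂ) :
    DifferentiableOn ℂ (fun p : ℂ × ℂ × ℂ × ℂ => fpIntegral a b α p.1 p.2.1 p.2.2.1 p.2.2.2)
      (fpDomain a α) :=
  differentiableOn_setIntegral measurableSet_Ioo (isOpen_fpDomain a α)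
    (fun _ hp => (continuousOn_fpIntegrand a b α hp).aestronglyMeasurable measurableSet_Ioo)
    (fun _ hu => differentiableOn_fpIntegrand a b α hu)
    (fun _ hp => exists_norm_fpIntegrand_le ha b hp)

/-! ### The case `x = 0` by an integral over a triangle -/

/-- Fubini for the extension of `H` by zero. Absolute integrability is required only with `u` as
inner variable, the order in which the scaling `u = q r` makes it explicit. -/
theorem setIntegral_triangle_swap {H : ℝ → ℝ → ℂ}
    (hmeas : ContinuousOn (Function.uncurry H) {p : ℝ × ℝ | 0 < p.1 ∧ p.1 < p.2 ∧ p.2 < 1})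
    (hslice : ∀ q ∈ Set.Ioo (0 : ℝ) 1, IntegrableOn (fun u => H u q) (Set.Ioo 0 q))
    (hint : IntegrableOn (fun q => ∫ u in Set.Ioo (0 : ℝ) q, ‖H u q‖) (Set.Ioo 0 1)) :
    ∫ u in Set.Ioo (0 : ℝ) 1, ∫ q in Set.Ioo u 1, H u q =
      ∫ q in Set.Ioo (0 : ℝ) 1, ∫ u in Set.Ioo (0 : ℝ) q, H u q := by
  set T : Set (ℝ × ℝ) := {p : ℝ × ℝ | 0 < p.1 ∧ p.1 < p.2 ∧ p.2 < 1} with hT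
  have hTm : MeasurableSet T := by
    have h1 : IsOpen {p : ℝ × ℝ | 0 < p.1} := isOpen_lt (by fun_prop) (by fun_prop)
    have h2 : IsOpen {p : ℝ × ℝ | p.1 < p.2} := isOpen_lt (by fun_prop) (by fun_prop)
    have h3 : IsOpen {p : ℝ × ℝ | p.2 < 1} := isOpen_lt (by fun_prop) (by fun_prop)
    exact (h1.inter (h2.inter h3)).measurableSet
  have hF1 : ∀ u q : ℝ, u ∈ Set.Ioo (0 : ℝ) 1 →
      T.indicator (Function.uncurry H) (u, q) = (Set.Ioo u 1).indicator (H u) q := by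
    intro u q hu
    by_cases h : q ∈ Set.Ioo u 1
    · rw [Set.indicator_of_mem h, Set.indicator_of_mem (show (u, q) ∈ T from ⟨hu.1, h⟩)]
      rfl
    · rw [Set.indicator_of_notMem h, Set.indicator_of_notMem fun h' : (u, q) ∈ T => h h'.2]
  have hF2 : ∀ u q : ℝ, q ∈ Set.Ioo (0 : ℝ) 1 →
      T.indicator (Function.uncurry H) (u, q) = (Set.Ioo 0 q).indicator (fun u => H u q) u := by
    intro u q hq
    by_cases h : u ∈ Set.Ioo 0 q
    · rw [Set.indicator_of_mem h, Set.indicator_of_mem (show (u, q) ∈ T from ⟨h.1, h.2, hq.2⟩)]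
      rfl
    · rw [Set.indicator_of_notMem h,
        Set.indicator_of_notMem fun h' : (u, q) ∈ T => h ⟨h'.1, h'.2.1⟩]
  have hF1' : ∀ u q : ℝ, u ∉ Set.Ioo (0 : ℝ) 1 → T.indicator (Function.uncurry H) (u, q) = 0 :=
    fun u q hu => Set.indicator_of_notMem
      (fun h : (u, q) ∈ T => hu ⟨h.1, h.2.1.trans h.2.2⟩) _
  have hF2' : ∀ u q : ℝ, q ∉ Set.Ioo (0 : ℝ) 1 → T.indicator (Function.uncurry H) (u, q) = 0 :=
    fun u q hq => Set.indicator_of_notMem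
      (fun h : (u, q) ∈ T => hq ⟨h.1.trans h.2.1, h.2.2⟩) _
  have hFm : AEStronglyMeasurable (T.indicator (Function.uncurry H)) (volume.prod volume) :=
    (aestronglyMeasurable_indicator_iff hTm).2 (hmeas.aestronglyMeasurable hTm)
  have hFi : Integrable (T.indicator (Function.uncurry H)) (volume.prod volume) := by
    rw [integrable_prod_iff' hFm]
    constructor
    · refine Eventually.of_forall fun q => ?_
      by_cases hq : q ∈ Set.Ioo (0 : ℝ) 1
      · simp_rw [hF2 _ q hq]
        exact (integrable_indicator_iff measurableSet_Ioo).2 (hslice q hq)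
      · simp_rw [hF2' _ q hq]
        exact integrable_zero _ _ _
    · refine ((integrable_indicator_iff measurableSet_Ioo).2 hint).congr
        (Eventually.of_forall fun q => ?_)
      by_cases hq : q ∈ Set.Ioo (0 : ℝ) 1
      · simp_rw [hF2 _ q hq, norm_indicator_eq_indicator_norm]
        rw [integral_indicator measurableSet_Ioo, Set.indicator_of_mem hq]
      · simp_rw [hF2' _ q hq]
        simp [Set.indicator_of_notMem hq]
  have hswap := integral_integral_swap (f := fun u q => T.indicator (Function.uncurry H) (u, q)) hFi
  rw [← integral_indicator measurableSet_Ioo, ← integral_indicator measurableSet_Ioo]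
  refine (integral_congr_ae (Eventually.of_forall fun u => ?_)).trans
    (hswap.trans (integral_congr_ae (Eventually.of_forall fun q => ?_)))
  · by_cases hu : u ∈ Set.Ioo (0 : ℝ) 1
    · simp_rw [hF1 u _ hu]
      rw [integral_indicator measurableSet_Ioo, Set.indicator_of_mem hu]
    · simp_rw [hF1' u _ hu]
      simp [Set.indicator_of_notMem hu]
  · by_cases hq : q ∈ Set.Ioo (0 : ℝ) 1
    · simp_rw [hF2 _ q hq]
      rw [integral_indicator measurableSet_Ioo, Set.indicator_of_mem hq]
    · simp_rw [hF2' _ q hq]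
      simp [Set.indicator_of_notMem hq]

theorem setIntegral_Ioo_comp_mul {E : Type*} [NormedAddCommGroup E] [NormedSpace ℝ E] (f : ℝ → E)
    {q : ℝ} (hq : 0 < q) :
    ∫ u in Set.Ioo (0 : ℝ) q, f u = q • ∫ r in Set.Ioo (0 : ℝ) 1, f (q * r) := by
  have h := intervalIntegral.smul_integral_comp_mul_left (a := 0) (b := 1) f q
  rw [mul_zero, mul_one, intervalIntegral.integral_of_le zero_le_one,
    intervalIntegral.integral_of_le hq.le, integral_Ioc_eq_integral_Ioo,
    integral_Ioc_eq_integral_Ioo] at h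
  exact h.symm

theorem integrableOn_Ioo_comp_mul {f : ℝ → ℂ} {q : ℝ} (hq : 0 < q)
    (h : IntegrableOn (fun r => f (q * r)) (Set.Ioo 0 1)) : IntegrableOn f (Set.Ioo 0 q) := by
  rw [← intervalIntegrable_iff_integrableOn_Ioo_of_le hq.le,
    ← IntervalIntegrable.comp_mul_left_iff hq.ne', zero_div, div_self hq.ne',
    intervalIntegrable_iff_integrableOn_Ioo_of_le zero_le_one]
  exact h

theorem mul_cpow_of_re_pos {y w : ℂ} (hy : 0 < y.re) (hw : 0 < w.re) (s : ℂ) :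
    (y * w) ^ s = y ^ s * w ^ s := by
  have hy0 : y ≠ 0 := by rintro rfl; simp at hy
  have hw0 : w ≠ 0 := by rintro rfl; simp at hw
  have h1 := abs_lt.1 (Complex.abs_arg_lt_pi_div_two_iff.2 (Or.inl hy))
  have h2 := abs_lt.1 (Complex.abs_arg_lt_pi_div_two_iff.2 (Or.inl hw))
  rw [Complex.cpow_def_of_ne_zero (mul_ne_zero hy0 hw0), Complex.cpow_def_of_ne_zero hy0,
    Complex.cpow_def_of_ne_zero hw0, Complex.log_mul hy0 hw0 ⟨by linarith, by linarith⟩, add_mul,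
    Complex.exp_add]

/-- The kernel that arises from Euler's integral in the substitution `q = u + (1 - u) t`. -/
noncomputable def triangleKernel (a α β δ y : ℂ) (u q : ℝ) : ℂ :=
  (u : ℂ) ^ (a - 1) * ((q : ℂ) - u) ^ (β - 1) * (1 - (q : ℂ)) ^ (δ - 1) *
    ((q : ℂ) - (1 - y) * u) ^ (-α)

/-- Homogeneity in `(u, q)` apart from the factor in `1 - q`: the variables separate. The
unsimplified exponent `a + β - a - 1` matches `eulerIntegral α a (a + β)`. -/
theorem triangleKernel_mul (a α β δ : ℂ) {y : ℂ} (hy : 1 - y ∈ planeMinusOneInfty) {q r : ℝ}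
    (hq : 0 < q) (hr : r ∈ Set.Ioo (0 : ℝ) 1) :
    triangleKernel a α β δ y (q * r) q =
      (q : ℂ) ^ (a + β - α - 1 - 1) * (1 - (q : ℂ)) ^ (δ - 1) *
        ((r : ℂ) ^ (a - 1) * (1 - (r : ℂ)) ^ (a + β - a - 1) *
          (1 - (1 - y) * (r : ℂ)) ^ (-α)) := by
  have hq0 : (q : ℂ) ≠ 0 := Complex.ofReal_ne_zero.2 hq.ne'
  have h1 := ofReal_mem_Ioo_slitPlane hr
  have h2 := one_sub_mul_mem_slitPlane hy (Set.Ioo_subset_Icc_self hr)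
  have e1 : (q : ℂ) - (q * r : ℝ) = q * (1 - r) := by push_cast; ring
  have e2 : (q : ℂ) - (1 - y) * (q * r : ℝ) = q * (1 - (1 - y) * r) := by push_cast; ring
  rw [triangleKernel, e1, e2, Complex.ofReal_mul,
    ofReal_mul_cpow hq (Complex.slitPlane_ne_zero h1.1),
    ofReal_mul_cpow hq (Complex.slitPlane_ne_zero h1.2),
    ofReal_mul_cpow hq (Complex.slitPlane_ne_zero h2),
    show a + β - α - 1 - 1 = (a - 1) + (β - 1) + -α by ring, Complex.cpow_add _ _ hq0,
    Complex.cpow_add _ _ hq0, show a + β - a - 1 = β - 1 by ring]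
  ring

theorem integrableOn_eulerIntegrand (α : ℂ) {β γ z : ℂ} (hβ : 0 < β.re) (hγβ : 0 < (γ - β).re)
    (hz : z ∈ planeMinusOneInfty) :
    IntegrableOn (fun t : ℝ => (t : ℂ) ^ (β - 1) * (1 - (t : ℂ)) ^ (γ - β - 1) *
      (1 - z * (t : ℂ)) ^ (-α)) (Set.Ioo 0 1) := by
  obtain ⟨C, -, hC⟩ := exists_norm_one_sub_mul_cpow_le α hz
  refine (integrableOn_cpow_mul_cpow hβ hγβ).mul_bdd (c := C) ?_ ?_
  · refine ContinuousOn.aestronglyMeasurable (fun t ht => ?_) measurableSet_Ioo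
    have h2 := one_sub_mul_mem_slitPlane hz (Set.Ioo_subset_Icc_self ht)
    exact ContinuousAt.continuousWithinAt (ContinuousAt.cpow (by fun_prop) (by fun_prop) h2)
  · exact (ae_restrict_iff' measurableSet_Ioo).2 (Eventually.of_forall fun t ht =>
      hC.self_of_nhds t (Set.Ioo_subset_Icc_self ht))

theorem continuousOn_triangleKernel (a α β δ : ℂ) {y : ℂ} (hy : 1 - y ∈ planeMinusOneInfty) :
    ContinuousOn (Function.uncurry (triangleKernel a α β δ y))
      {p : ℝ × ℝ | 0 < p.1 ∧ p.1 < p.2 ∧ p.2 < 1} := by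
  rintro ⟨u, q⟩ ⟨hu, huq, hq⟩
  simp only at hu huq hq
  have hq0 : 0 < q := hu.trans huq
  have h1 : (u : ℂ) ∈ Complex.slitPlane := Complex.ofReal_mem_slitPlane.2 hu
  have h2 : (q : ℂ) - u ∈ Complex.slitPlane := by
    rw [← Complex.ofReal_sub]; exact Complex.ofReal_mem_slitPlane.2 (sub_pos.2 huq)
  have h3 : 1 - (q : ℂ) ∈ Complex.slitPlane := (ofReal_mem_Ioo_slitPlane ⟨hq0, hq⟩).2
  have h4 : (q : ℂ) - (1 - y) * u ∈ Complex.slitPlane := by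
    have hr : u / q ∈ Set.Icc (0 : ℝ) 1 := ⟨by positivity, (div_le_one hq0).2 huq.le⟩
    have h := one_sub_mul_mem_slitPlane hy hr
    have hq0' : (q : ℂ) ≠ 0 := Complex.ofReal_ne_zero.2 hq0.ne'
    have e : (q : ℂ) - (1 - y) * u = q * (1 - (1 - y) * ((u / q : ℝ) : ℂ)) := by
      push_cast; field_simp
    rw [e]
    rw [Complex.mem_slitPlane_iff] at h ⊢
    rw [Complex.re_ofReal_mul, Complex.im_ofReal_mul]
    exact h.imp (fun h => mul_pos hq0 h) (fun h => mul_ne_zero hq0.ne' h)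
  refine ContinuousAt.continuousWithinAt ?_
  change ContinuousAt (fun p : ℝ × ℝ => (p.1 : ℂ) ^ (a - 1) * ((p.2 : ℂ) - p.1) ^ (β - 1) *
    (1 - (p.2 : ℂ)) ^ (δ - 1) * ((p.2 : ℂ) - (1 - y) * p.1) ^ (-α)) (u, q)
  refine ContinuousAt.mul (ContinuousAt.mul (ContinuousAt.mul ?_ ?_) ?_) ?_
  · exact ContinuousAt.cpow (by fun_prop) (by fun_prop) h1
  · exact ContinuousAt.cpow (by fun_prop) (by fun_prop) h2
  · exact ContinuousAt.cpow (by fun_prop) (by fun_prop) h3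
  · exact ContinuousAt.cpow (by fun_prop) (by fun_prop) h4

theorem setIntegral_triangleKernel {a α β δ y : ℂ} (ha : 0 < a.re) (hβ : 0 < β.re)
    (haβ : 0 < (a + β - α).re) (hδ : 0 < δ.re) (hy : 1 - y ∈ planeMinusOneInfty) :
    ∫ u in Set.Ioo (0 : ℝ) 1, ∫ q in Set.Ioo u 1, triangleKernel a α β δ y u q =
      Complex.Gamma (a + β - α) * Complex.Gamma δ / Complex.Gamma (a + β - α + δ) *
        eulerIntegral α a (a + β) (1 - y) := by
  have hE := integrableOn_eulerIntegrand α (β := a) (γ := a + β) ha (by simpa using hβ) hy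
  have hk := integrableOn_cpow_mul_cpow haβ hδ
  have hqc : ∀ q ∈ Set.Ioo (0 : ℝ) 1,
      (q : ℂ) * ((q : ℂ) ^ (a + β - α - 1 - 1) * (1 - (q : ℂ)) ^ (δ - 1)) =
        (q : ℂ) ^ (a + β - α - 1) * (1 - (q : ℂ)) ^ (δ - 1) := by
    intro q hq
    have hq0 : (q : ℂ) ≠ 0 := Complex.ofReal_ne_zero.2 hq.1.ne'
    rw [Complex.cpow_sub (a + β - α - 1) 1 hq0, Complex.cpow_one]
    field_simp
  rw [setIntegral_triangle_swap (continuousOn_triangleKernel a α β δ hy)]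
  · have hcongr : Set.EqOn (fun q : ℝ => ∫ u in Set.Ioo (0 : ℝ) q, triangleKernel a α β δ y u q)
        (fun q : ℝ => (q : ℂ) ^ (a + β - α - 1) * (1 - (q : ℂ)) ^ (δ - 1) *
          eulerIntegral α a (a + β) (1 - y)) (Set.Ioo 0 1) := by
      intro q hq
      simp only
      rw [setIntegral_Ioo_comp_mul _ hq.1, setIntegral_congr_fun measurableSet_Ioo
        fun r hr => triangleKernel_mul a α β δ hy hq.1 hr, integral_const_mul, ← hqc q hq,
        Complex.real_smul, eulerIntegral]
      ring
    rw [setIntegral_congr_fun measurableSet_Ioo hcongr, integral_mul_const,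
      setIntegral_cpow_mul_cpow haβ hδ]
  · intro q hq
    refine integrableOn_Ioo_comp_mul hq.1 ?_
    refine IntegrableOn.congr_fun (hE.const_mul _)
      (fun r hr => (triangleKernel_mul a α β δ hy hq.1 hr).symm) measurableSet_Ioo
  · refine IntegrableOn.congr_fun (f := fun q : ℝ =>
      ‖(q : ℂ) ^ (a + β - α - 1) * (1 - (q : ℂ)) ^ (δ - 1)‖ * ∫ r in Set.Ioo (0 : ℝ) 1,
      ‖(r : ℂ) ^ (a - 1) * (1 - (r : ℂ)) ^ (a + β - a - 1) * (1 - (1 - y) * (r : ℂ)) ^ (-α)‖)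
      (hk.norm.mul_const _) (fun q hq => ?_) measurableSet_Ioo
    simp only
    rw [setIntegral_Ioo_comp_mul _ hq.1, ← hqc q hq, norm_mul (q : ℂ),
      Complex.norm_of_nonneg hq.1.le, smul_eq_mul, mul_assoc, ← integral_const_mul]
    congr 1
    refine setIntegral_congr_fun measurableSet_Ioo fun r hr => ?_
    rw [triangleKernel_mul a α β δ hy hq.1 hr]
    simp only [norm_mul]

/-- Euler's integral under `q = u + (1 - u) t`. If `w` is the base of its last power, then `q - (1 -
y) u = u y w`. Since `Re y > 0` forces `Re w > 0`, the principal powers of `y` and `w` multiply. -/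
theorem fpIntegrand_eq_setIntegral_triangleKernel {a α β γ y : ℂ} (b : ℂ) (hβ : 0 < β.re)
    (hγβ : 0 < (γ - β).re) (hy : 0 < y.re) {u : ℝ} (hu : u ∈ Set.Ioo (0 : ℝ) 1) :
    fpIntegrand a b α β γ 0 y u =
      Complex.Gamma γ / (Complex.Gamma β * Complex.Gamma (γ - β)) * y ^ α *
        ∫ q in Set.Ioo u 1, triangleKernel a α β (γ - β) y u q := by
  have h1u : 0 < 1 - u := sub_pos.2 hu.2
  have hu0 : (u : ℂ) ≠ 0 := Complex.ofReal_ne_zero.2 hu.1.ne'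
  have h1u0 : (1 - (u : ℂ)) ≠ 0 := by exact_mod_cast h1u.ne'
  have hy0 : y ≠ 0 := by rintro rfl; simp at hy
  have hsub : ∫ q in Set.Ioo u 1, triangleKernel a α β (γ - β) y u q =
      (1 - u) • ∫ t in Set.Ioo (0 : ℝ) 1, triangleKernel a α β (γ - β) y u (u + (1 - u) * t) := by
    have h := intervalIntegral.integral_comp_add_mul (a := 0) (b := 1)
      (fun q => triangleKernel a α β (γ - β) y u q) h1u.ne' u
    rw [mul_zero, mul_one, add_zero, add_sub_cancel, intervalIntegral.integral_of_le zero_le_one,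
      intervalIntegral.integral_of_le hu.2.le, integral_Ioc_eq_integral_Ioo,
      integral_Ioc_eq_integral_Ioo] at h
    rw [h, smul_smul, mul_inv_cancel₀ h1u.ne', one_smul]
  have hz : y⁻¹ * (1 - (u : ℂ)⁻¹) ∈ planeMinusOneInfty := inv_mul_one_sub_inv_mem (Or.inl hy) hu
  rw [hsub, fpIntegrand, gaussHypergeometric_eq_eulerIntegral α hβ hγβ hz, eulerIntegral,
    Complex.real_smul]
  have key : (u : ℂ) ^ (a - α - 1) * (1 - (u : ℂ)) ^ (γ - 1) *
      ∫ t in Set.Ioo (0 : ℝ) 1, (t : ℂ) ^ (β - 1) * (1 - (t : ℂ)) ^ (γ - β - 1) *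
        (1 - y⁻¹ * (1 - (u : ℂ)⁻¹) * (t : ℂ)) ^ (-α) = y ^ α * ((1 - u : ℝ) : ℂ) *
      ∫ t in Set.Ioo (0 : ℝ) 1, triangleKernel a α β (γ - β) y u (u + (1 - u) * t) := by
    rw [← integral_const_mul, ← integral_const_mul]
    refine setIntegral_congr_fun measurableSet_Ioo fun t ht => ?_
    have h1t : 0 < 1 - t := sub_pos.2 ht.2
    have ht0 : (t : ℂ) ≠ 0 := Complex.ofReal_ne_zero.2 ht.1.ne'
    have h1t0 : (1 - (t : ℂ)) ≠ 0 := by exact_mod_cast h1t.ne'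
    have e1 : ((u + (1 - u) * t : ℝ) : ℂ) - u = ((1 - u : ℝ) : ℂ) * t := by push_cast; ring
    have e2 : 1 - ((u + (1 - u) * t : ℝ) : ℂ) = ((1 - u : ℝ) : ℂ) * (1 - t) := by push_cast; ring
    set w : ℂ := 1 - y⁻¹ * (1 - (u : ℂ)⁻¹) * (t : ℂ) with hw
    have e3 : ((u + (1 - u) * t : ℝ) : ℂ) - (1 - y) * u = u * (y * w) := by
      rw [hw]; push_cast; field_simp; ring
    have hwre : 0 < w.re := by
      have hyi : 0 < (y⁻¹).re := by
        rw [Complex.inv_re]; exact div_pos hy (Complex.normSq_pos.2 hy0)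
      have : w = 1 + (((1 - u) / u * t : ℝ) : ℂ) * y⁻¹ := by
        rw [hw]; push_cast; field_simp; ring
      rw [this, Complex.add_re, Complex.re_ofReal_mul, Complex.one_re]
      have := hu.1
      have := ht.1
      positivity
    have hw0 : w ≠ 0 := by intro h; rw [h] at hwre; simp at hwre
    rw [triangleKernel, e1, e2, e3, ofReal_mul_cpow h1u ht0, ofReal_mul_cpow h1u h1t0,
      ofReal_mul_cpow hu.1 (mul_ne_zero hy0 hw0), mul_cpow_of_re_pos hy hwre,
      show a - α - 1 = (a - 1) + -α by ring, Complex.cpow_add _ _ hu0,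
      show γ - 1 = 1 + (β - 1) + (γ - β - 1) by ring, Complex.ofReal_sub, Complex.ofReal_one,
      Complex.cpow_add _ _ h1u0, Complex.cpow_add _ _ h1u0, Complex.cpow_one,
      Complex.cpow_neg y]
    have hyα : y ^ α ≠ 0 := by simp [Complex.cpow_eq_zero_iff, hy0]
    field_simp
  rw [zero_mul, sub_zero, Complex.one_cpow, mul_one]
  linear_combination Complex.Gamma γ / (Complex.Gamma β * Complex.Gamma (γ - β)) * key

theorem fpIntegral_zero_of_euler {a α β γ y : ℂ} (b : ℂ) (ha : 0 < a.re) (hβ : 0 < β.re)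
    (haβ : 0 < (a + β - α).re) (hγβ : 0 < (γ - β).re) (hy : 0 < y.re) :
    fpIntegral a b α β γ 0 y =
      y ^ α * (Complex.Gamma γ * Complex.Gamma a * Complex.Gamma (a + β - α) *
        (Complex.Gamma (γ + a - α))⁻¹ * (Complex.Gamma (a + β))⁻¹) *
        gaussHypergeometric α a (a + β) (1 - y) := by
  have hy' : 1 - y ∈ planeMinusOneInfty := by
    rw [mem_planeMinusOneInfty_iff, sub_sub_cancel]; exact Or.inl hy
  rw [fpIntegral, setIntegral_congr_fun measurableSet_Ioo fun u hu =>
    fpIntegrand_eq_setIntegral_triangleKernel b hβ hγβ hy hu, integral_const_mul,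
    setIntegral_triangleKernel ha hβ haβ hγβ hy',
    gaussHypergeometric_eq_eulerIntegral α ha (by simpa using hβ) hy', add_sub_cancel_left,
    show a + β - α + (γ - β) = γ + a - α by ring]
  have h1 := Complex.Gamma_ne_zero_of_re_pos ha
  have h2 := Complex.Gamma_ne_zero_of_re_pos hβ
  have h3 := Complex.Gamma_ne_zero_of_re_pos hγβ
  have h4 : Complex.Gamma (a + β) ≠ 0 := Complex.Gamma_ne_zero_of_re_pos (by simp; linarith)
  field_simp

/-! ### Continuation of the case `x = 0` in the parameters -/

/-- Both sides are holomorphic in `t` at `(β + t, γ + 2 t)`, and for large `Re t` the Euler case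
applies. The values of `t` with `a + β + t` in `{0, -1, -2, ...}` must be avoided, so the
continuation runs on the side of the real axis, chosen by the sign `ε`, where `a + β` lies. -/
theorem fpIntegral_zero_of_im {a α β γ y : ℂ} (b : ℂ) (ha : 0 < a.re) (haβ : 0 < (a + β - α).re)
    (hγ : 0 < γ.re) (hδ : ∀ n : ℕ, a + β ≠ -(n : ℂ)) (hy : 0 < y.re) {ε : ℝ} (hε : ε * ε = 1)
    (hεδ : 0 ≤ ε * (a + β).im) :
    fpIntegral a b α β γ 0 y =
      y ^ α * (Complex.Gamma γ * Complex.Gamma a * Complex.Gamma (a + β - α) *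
        (Complex.Gamma (γ + a - α))⁻¹ * (Complex.Gamma (a + β))⁻¹) *
        gaussHypergeometric α a (a + β) (1 - y) := by
  have hy' : 1 - y ∈ planeMinusOneInfty := by
    rw [mem_planeMinusOneInfty_iff, sub_sub_cancel]; exact Or.inl hy
  -- `Re t > -η` preserves `Re (γ + 2 t) > 0` and `Re (a + β + t - α) > 0`.
  obtain ⟨η, hη0, hη⟩ := exists_between (lt_min (half_pos hγ) haβ)
  obtain ⟨hη1, hη2⟩ := lt_min_iff.1 hη
  have hnhds : ∀ᶠ t : ℂ in 𝓝 0, ∀ n : ℕ, a + (β + t) ≠ -(n : ℂ) := by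
    have hc : Tendsto (fun t : ℂ => a + (β + t)) (𝓝 0) (𝓝 (a + β)) :=
      Continuous.tendsto' (by fun_prop) _ _ (by simp)
    exact hc.eventually (isOpen_ne_neg_natCast.mem_nhds hδ)
  obtain ⟨r', hr'0, hr'⟩ := Metric.eventually_nhds_iff_ball.1 hnhds
  set r := min r' η with hr
  have hr0 : 0 < r := lt_min hr'0 hη0
  -- On `A` the number `a + β + t` is not real. When `a + β` is real, `0` lies on the boundary of
  -- `A`, hence the additional ball around `0`.
  set A : Set ℂ := {t | -η < t.re} ∩ {t | -(ε * (a + β).im) < ε * t.im} with hA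
  set V : Set ℂ := A ∪ Metric.ball 0 r with hV
  have hlin : IsLinearMap ℝ fun t : ℂ => ε * t.im :=
    ⟨fun s t => by simp [mul_add], fun c t => by simp; ring⟩
  have hAc : Convex ℝ A := (convex_halfSpace_re_gt _).inter (convex_halfSpace_gt hlin _)
  have hAo : IsOpen A :=
    (isOpen_lt continuous_const Complex.continuous_re).inter
      (isOpen_lt continuous_const (by fun_prop))
  have hVo : IsOpen V := hAo.union Metric.isOpen_ball
  have hVc : IsPreconnected V := by
    refine IsPreconnected.union (((ε * (r / 2) : ℝ) : ℂ) * Complex.I) ?_ ?_ hAc.isPreconnected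
      (convex_ball _ _).isPreconnected
    · constructor
      · simpa using hη0
      · simp only [Set.mem_ofPred_eq, Complex.im_ofReal_mul, Complex.I_im, mul_one]
        rw [← mul_assoc, hε]
        linarith
    · have hε1 : |ε| = 1 := by
        have := abs_mul_abs_self ε
        rw [hε] at this
        nlinarith [abs_nonneg ε]
      simp only [mem_ball_zero_iff, norm_mul, Complex.norm_I, mul_one, Complex.norm_real,
        Real.norm_eq_abs, hε1, one_mul]
      rw [abs_of_pos (half_pos hr0)]
      linarith
  have hVη : ∀ t ∈ V, -η < t.re := by
    rintro t (ht | ht)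
    · exact ht.1
    · have h1 : ‖t‖ < r := by simpa using ht
      have h2 := (abs_le.1 (Complex.abs_re_le_norm t)).1
      have h3 : r ≤ η := min_le_right _ _
      linarith
  have hVδ : ∀ t ∈ V, ∀ n : ℕ, a + (β + t) ≠ -(n : ℂ) := by
    rintro t (ht | ht) n
    · intro h
      have h1 := congrArg Complex.im h
      simp only [Complex.add_im, Complex.neg_im, Complex.natCast_im, neg_zero] at h1
      have h2 : -(ε * (a + β).im) < ε * t.im := ht.2
      rw [Complex.add_im] at h2
      have : ε * (a.im + β.im) + ε * t.im = ε * (a.im + (β.im + t.im)) := by ring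
      rw [h1, mul_zero] at this
      linarith
    · exact hr' t (Metric.ball_subset_ball (min_le_left _ _) ht) n
  have hVγ : ∀ t ∈ V, 0 < (γ + 2 * t).re := fun t ht => by
    have := hVη t ht
    simp
    linarith
  have hVβ : ∀ t ∈ V, 0 < (a + (β + t) - α).re := fun t ht => by
    have := hVη t ht
    simp at hη2 ⊢
    linarith
  set L : ℂ → ℂ := fun t => fpIntegral a b α (β + t) (γ + 2 * t) 0 y with hL
  set R : ℂ → ℂ := fun t => y ^ α * (Complex.Gamma (γ + 2 * t) * Complex.Gamma a *
    Complex.Gamma (a + (β + t) - α) * (Complex.Gamma (γ + 2 * t + a - α))⁻¹ *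
    (Complex.Gamma (a + (β + t)))⁻¹) * gaussHypergeometric α a (a + (β + t)) (1 - y) with hR
  have hLd : DifferentiableOn ℂ L V := by
    refine (differentiableOn_fpIntegral ha b (α := α)).comp
      (f := fun t => (β + t, γ + 2 * t, (0 : ℂ), y)) (by fun_prop) fun t ht => ⟨?_, hVγ t ht,
        mem_planeMinusOneInfty_of_norm_lt_one (by simp), Or.inl hy⟩
    have := hVβ t ht
    simp at this ⊢
    linarith
  have hRd : DifferentiableOn ℂ R V := by
    refine DifferentiableOn.mul (DifferentiableOn.const_mul (DifferentiableOn.mul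
      (DifferentiableOn.mul (DifferentiableOn.mul (DifferentiableOn.mul_const ?_ _) ?_) ?_) ?_) _) ?_
    · intro t ht
      exact (DifferentiableAt.comp t (f := fun t => γ + 2 * t) (Complex.differentiableAt_Gamma _
        (ne_neg_natCast_of_re_pos (hVγ t ht))) (by fun_prop)).differentiableWithinAt
    · intro t ht
      exact (DifferentiableAt.comp t (f := fun t => a + (β + t) - α)
        (Complex.differentiableAt_Gamma _ (ne_neg_natCast_of_re_pos (hVβ t ht)))
        (by fun_prop)).differentiableWithinAt
    · exact (Complex.differentiable_one_div_Gamma.comp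
        (f := fun t => γ + 2 * t + a - α) (by fun_prop)).differentiableOn
    · exact (Complex.differentiable_one_div_Gamma.comp
        (f := fun t => a + (β + t)) (by fun_prop)).differentiableOn
    · exact (differentiableOn_gaussHypergeometric α).comp
        (f := fun t => (a, a + (β + t), 1 - y)) (by fun_prop) fun t ht => ⟨hVδ t ht, hy'⟩
  -- For `Re t > T` both `β + t` and `(γ + 2 t) - (β + t)` have positive real part.
  set T := max 0 (max (-β.re) (-(γ - β).re)) with hT
  have hT0 : 0 ≤ T := le_max_left _ _
  have hT1 : -β.re ≤ T := (le_max_left _ _).trans (le_max_right _ _)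
  have hT2 : -(γ - β).re ≤ T := (le_max_right _ _).trans (le_max_right _ _)
  rw [Complex.sub_re] at hT2
  set W : Set ℂ := {t | T < t.re} ∩ {t | -(ε * (a + β).im) < ε * t.im} with hW
  have hWo : IsOpen W := (isOpen_lt continuous_const Complex.continuous_re).inter
      (isOpen_lt continuous_const (by fun_prop))
  have hWV : W ⊆ V := fun t ht =>
    Or.inl ⟨show -η < t.re by have : T < t.re := ht.1; linarith, ht.2⟩
  have hWne : W.Nonempty := by
    refine ⟨((T + 1 : ℝ) : ℂ) + (ε : ℂ) * Complex.I, ?_, ?_⟩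
    · simp
    · simp only [Set.mem_ofPred_eq, Complex.add_im, Complex.ofReal_im, Complex.im_ofReal_mul,
        Complex.I_im, mul_one, zero_add, hε]
      rw [Complex.add_im] at hεδ
      linarith
  have hWeq : Set.EqOn L R W := by
    intro t ht
    have htT : T < t.re := ht.1
    refine fpIntegral_zero_of_euler b ha ?_ (hVβ t (hWV ht)) ?_ hy
    · rw [Complex.add_re]; linarith
    · simp
      linarith
  have h0 := eqOn_of_eqOn_open hVo hVc hWo hWV hWne hLd hRd hWeq
    (Or.inr (Metric.mem_ball_self hr0) : (0 : ℂ) ∈ V)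
  simpa [hL, hR] using h0

/-- The representation for `x = 0`. -/
theorem fpIntegral_zero {a α β γ y : ℂ} (b : ℂ) (ha : 0 < a.re) (haβ : 0 < (a + β - α).re)
    (hγ : 0 < γ.re) (hδ : ∀ n : ℕ, a + β ≠ -(n : ℂ)) (hy : 0 < y.re) :
    fpIntegral a b α β γ 0 y =
      y ^ α * (Complex.Gamma γ * Complex.Gamma a * Complex.Gamma (a + β - α) *
        (Complex.Gamma (γ + a - α))⁻¹ * (Complex.Gamma (a + β))⁻¹) *
        gaussHypergeometric α a (a + β) (1 - y) := by
  rcases le_total 0 (a + β).im with h | h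
  · exact fpIntegral_zero_of_im b ha haβ hγ hδ hy (ε := 1) (by norm_num) (by simpa using h)
  · exact fpIntegral_zero_of_im b ha haβ hγ hδ hy (ε := -1) (by norm_num) (by linarith)

/-! ### Expansion into the double series -/

theorem hasSum_fpIntegral {a α β γ x y : ℂ} (b : ℂ) (ha : 0 < a.re) (haβ : 0 < (a + β - α).re)
    (hγ : 0 < γ.re) (hx : ‖x‖ < 1) (hy : y ∈ Complex.slitPlane) :
    HasSum (fun k : ℕ => poch b k / (k ! : ℂ) * x ^ k * fpIntegral (a + k) b α β γ 0 y)
      (fpIntegral a b α β γ x y) := by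
  have hmem : (β, γ, (0 : ℂ), y) ∈ fpDomain a α :=
    ⟨by simp at haβ ⊢; linarith, hγ, mem_planeMinusOneInfty_of_norm_lt_one (by simp), hy⟩
  have h := hasSum_setIntegral_one_sub_mul_cpow b hx (integrableOn_fpIntegrand ha b hmem)
  have e1 : ∀ k : ℕ, ∫ u in Set.Ioo (0 : ℝ) 1, (u : ℂ) ^ k * fpIntegrand a b α β γ 0 y u =
      fpIntegral (a + k) b α β γ 0 y := fun k => by
    refine setIntegral_congr_fun measurableSet_Ioo fun u hu => ?_
    have hu0 : (u : ℂ) ≠ 0 := Complex.ofReal_ne_zero.2 hu.1.ne'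
    simp only [fpIntegrand]
    rw [show a + k - α - 1 = k + (a - α - 1) by ring, Complex.cpow_add _ _ hu0,
      Complex.cpow_natCast]
    ring
  have e2 : ∫ u in Set.Ioo (0 : ℝ) 1, (1 - x * (u : ℂ)) ^ (-b) * fpIntegrand a b α β γ 0 y u =
      fpIntegral a b α β γ x y := by
    refine integral_congr_ae (Eventually.of_forall fun u => ?_)
    simp only [fpIntegrand]
    rw [zero_mul, sub_zero, Complex.one_cpow]
    ring
  simp only at e1 e2 h
  rw [e2] at h
  exact h.of_eq fun k => by rw [e1 k]

/-- The terms of Olsson's double series. -/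
noncomputable def olssonFPTerm (a b₁ b₂ c₁ c₂ x y : ℂ) (n : ℕ × ℕ) : ℂ :=
  poch a (n.1 + n.2) * poch (a - c₂ + 1) n.1 * poch b₁ n.1 * poch b₂ n.2 /
      (poch (a + b₂ - c₂ + 1) (n.1 + n.2) * poch c₁ n.1 * (n.1 ! : ℂ) * (n.2 ! : ℂ)) *
      x ^ n.1 * (1 - y) ^ n.2

theorem summable_olssonFPTerm {a b₁ b₂ c₁ c₂ x y : ℂ} (hc₁ : ∀ n : ℕ, c₁ ≠ -(n : ℂ))
    (hden : ∀ n : ℕ, a + b₂ - c₂ + 1 ≠ -(n : ℂ)) (hx : ‖x‖ < 1) (hy : ‖1 - y‖ < 1) :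
    Summable (olssonFPTerm a b₁ b₂ c₁ c₂ x y) := by
  obtain ⟨K₁, h₁⟩ := exists_norm_poch_le a hden
  obtain ⟨K₂, h₂⟩ := exists_norm_poch_le (a - c₂ + 1) hc₁
  obtain ⟨K₃, h₃⟩ := exists_norm_poch_div_factorial_le b₁
  obtain ⟨K₄, h₄⟩ := exists_norm_poch_div_factorial_le b₂
  have hs := (summable_add_one_pow_mul_pow (K₁ + K₂ + K₃) (norm_nonneg x) hx).mul_of_nonneg
    (summable_add_one_pow_mul_pow (K₁ + K₄) (norm_nonneg (1 - y)) hy)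
    (fun i => by positivity) (fun i => by positivity)
  refine Summable.of_norm_bounded hs fun ⟨i, j⟩ => ?_
  have e : olssonFPTerm a b₁ b₂ c₁ c₂ x y (i, j) =
      (poch a (i + j) / poch (a + b₂ - c₂ + 1) (i + j)) * (poch (a - c₂ + 1) i / poch c₁ i) *
        (poch b₁ i / (i ! : ℂ)) * (poch b₂ j / (j ! : ℂ)) * x ^ i * (1 - y) ^ j := by
    simp only [olssonFPTerm, div_mul_div_comm]
  have b1 : ‖poch a (i + j) / poch (a + b₂ - c₂ + 1) (i + j)‖ ≤
      -- `i + j + 1 ≤ (i + 1) (j + 1)` separates the two indices, so that a product of two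
      -- convergent series dominates.
      ((i : ℝ) + 1) ^ K₁ * ((j : ℝ) + 1) ^ K₁ := by
    rw [norm_div, div_le_iff₀ (norm_pos_iff.2 (poch_ne_zero hden _))]
    refine (h₁ (i + j)).trans ?_
    rw [← mul_pow]
    gcongr
    push_cast
    nlinarith [mul_nonneg (i.cast_nonneg (α := ℝ)) (j.cast_nonneg (α := ℝ))]
  have b2 : ‖poch (a - c₂ + 1) i / poch c₁ i‖ ≤ ((i : ℝ) + 1) ^ K₂ := by
    rw [norm_div, div_le_iff₀ (norm_pos_iff.2 (poch_ne_zero hc₁ _))]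
    exact h₂ i
  rw [e]
  simp only [norm_mul, norm_pow]
  calc _ ≤ (((i : ℝ) + 1) ^ K₁ * ((j : ℝ) + 1) ^ K₁) * ((i : ℝ) + 1) ^ K₂ * ((i : ℝ) + 1) ^ K₃ *
        ((j : ℝ) + 1) ^ K₄ * ‖x‖ ^ i * ‖1 - y‖ ^ j := by
        gcongr
        · exact h₃ i
        · exact h₄ j
    _ = _ := by ring

/-- The constant in front of the integral representation. -/
noncomputable def fpConstant (a b₂ c₁ c₂ : ℂ) : ℂ :=
  Complex.Gamma c₁ * Complex.Gamma (a + b₂ - c₂ + 1) /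
    (Complex.Gamma a * Complex.Gamma (a - c₂ + 1) * Complex.Gamma (b₂ + c₁ - a))

/-- For fixed `i`, the sum over `j` is a Gauss series in `1 - y` with parameters `b₂, a + i; a + b₂
- c₂ + 1 + i`, which is the value of the integral at `x = 0` with `a + i` for `a`. Absolute
convergence allows summing by rows, and `y ^ b₂` cancels the prefactor. -/
theorem fpConstant_mul_fpIntegral_eq_olssonFPSeries {a b₁ b₂ c₁ c₂ x y : ℂ}
    (ha : 0 < a.re) (hac : 0 < (a - c₂ + 1).re) (hbca : 0 < (b₂ + c₁ - a).re)
    (hc₁ : ∀ n : ℕ, c₁ ≠ -(n : ℂ)) (hden : ∀ n : ℕ, a + b₂ - c₂ + 1 ≠ -(n : ℂ))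
    (hx : ‖x‖ < 1) (hy : ‖1 - y‖ < 1) :
    fpConstant a b₂ c₁ c₂ *
      (y ^ (-b₂) * fpIntegral a b₁ b₂ (b₂ - c₂ + 1) (b₂ + c₁ - a) x y) =
      olssonFPSeries a b₁ b₂ c₁ c₂ (x, y) := by
  have hyre : 0 < y.re := by
    have := (Complex.re_le_norm (1 - y)).trans_lt hy
    simp at this
    linarith
  have hy0 : y ≠ 0 := by rintro rfl; simp at hyre
  have g1 := Complex.Gamma_ne_zero_of_re_pos ha
  have g2 := Complex.Gamma_ne_zero_of_re_pos hac
  have g3 := Complex.Gamma_ne_zero_of_re_pos hbca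
  have g4 := Complex.Gamma_ne_zero hc₁
  have g5 := Complex.Gamma_ne_zero hden
  have p1 := fun k => poch_ne_zero hc₁ k
  have p2 := fun k => poch_ne_zero hden k
  have hS := (summable_olssonFPTerm (b₁ := b₁) hc₁ hden hx hy).hasSum
  have hI := (hasSum_fpIntegral (α := b₂) (β := b₂ - c₂ + 1) (x := x) (y := y) b₁ ha
    (by convert hac using 2; ring) hbca hx (Or.inl hyre)).mul_left
    (fpConstant a b₂ c₁ c₂ * y ^ (-b₂))
  rw [← mul_assoc]
  refine hI.unique (HasSum.prod_fiberwise hS fun i => ?_)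
  have hden' : ∀ n : ℕ, a + i + (b₂ - c₂ + 1) ≠ -(n : ℂ) := fun n h =>
    hden (i + n) (by push_cast; linear_combination h)
  have hai : 0 < (a + (i : ℂ)).re := by simp; positivity
  have haci : 0 < (a + (i : ℂ) + (b₂ - c₂ + 1) - b₂).re := by
    simp at hac ⊢
    have := i.cast_nonneg (α := ℝ)
    linarith
  rw [fpIntegral_zero b₁ hai haci hbca hden' hyre,
    gaussHypergeometric_eq_ordinaryHypergeometric _ _ hden' hy]
  have hG := (hasSum_ordinaryHypergeometric b₂ (a + i) hden' hy).mul_left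
    (fpConstant a b₂ c₁ c₂ * y ^ (-b₂) * (poch b₁ i / (i ! : ℂ) * x ^ i *
    (y ^ b₂ * (Complex.Gamma (b₂ + c₁ - a) * Complex.Gamma (a + i) *
      Complex.Gamma (a + i + (b₂ - c₂ + 1) - b₂) *
      (Complex.Gamma (b₂ + c₁ - a + (a + i) - b₂))⁻¹ *
      (Complex.Gamma (a + i + (b₂ - c₂ + 1)))⁻¹))))
  have e : ∀ z : ℂ, fpConstant a b₂ c₁ c₂ * y ^ (-b₂) * (poch b₁ i / (i ! : ℂ) * x ^ i *
    (y ^ b₂ * (Complex.Gamma (b₂ + c₁ - a) * Complex.Gamma (a + i) *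
      Complex.Gamma (a + i + (b₂ - c₂ + 1) - b₂) *
      (Complex.Gamma (b₂ + c₁ - a + (a + i) - b₂))⁻¹ *
      (Complex.Gamma (a + i + (b₂ - c₂ + 1)))⁻¹) * z)) = fpConstant a b₂ c₁ c₂ * y ^ (-b₂) *
      (poch b₁ i / (i ! : ℂ) * x ^ i *
    (y ^ b₂ * (Complex.Gamma (b₂ + c₁ - a) * Complex.Gamma (a + i) *
      Complex.Gamma (a + i + (b₂ - c₂ + 1) - b₂) *
      (Complex.Gamma (b₂ + c₁ - a + (a + i) - b₂))⁻¹ *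
      (Complex.Gamma (a + i + (b₂ - c₂ + 1)))⁻¹))) * z := fun z => by ring
  rw [e]
  refine hG.of_eq fun j => ?_
  rw [show a + i + (b₂ - c₂ + 1) - b₂ = (a - c₂ + 1) + i by ring,
    show b₂ + c₁ - a + (a + i) - b₂ = c₁ + i by ring,
    show a + i + (b₂ - c₂ + 1) = (a + b₂ - c₂ + 1) + i by ring,
    Gamma_add_nat_eq_poch_mul (ne_neg_natCast_of_re_pos ha),
    Gamma_add_nat_eq_poch_mul (ne_neg_natCast_of_re_pos hac),
    Gamma_add_nat_eq_poch_mul hc₁, Gamma_add_nat_eq_poch_mul hden, fpConstant, gaussCoeff,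
    olssonFPTerm, Complex.cpow_neg]
  simp only [poch_add]
  have p3 := p2 (i + j)
  rw [poch_add] at p3
  have hyb : y ^ b₂ ≠ 0 := by simp [Complex.cpow_eq_zero_iff, hy0]
  have := p1 i
  have := left_ne_zero_of_mul p3
  have := right_ne_zero_of_mul p3
  have : (i ! : ℂ) ≠ 0 := by exact_mod_cast i.factorial_ne_zero
  have : (j ! : ℂ) ≠ 0 := by exact_mod_cast j.factorial_ne_zero
  field_simp

/-! ### Uniqueness in two variables and conclusion -/

/-- The one-variable identity theorem twice: in `x` for each `y` in the disk around `1`, and then in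
`y` for each `x` in the cut plane. -/
theorem olssonFP_eqOn {a b₁ b₂ c₁ c₂ : ℂ} {H : ℂ × ℂ → ℂ} (hH : DifferentiableOn ℂ H olssonFPDomain)
    (h : Set.EqOn H (olssonFPSeries a b₁ b₂ c₁ c₂) olssonFPDisk) :
    Set.EqOn (olssonFP a b₁ b₂ c₁ c₂) H olssonFPDomain := by
  have hex : ∃ F : ℂ × ℂ → ℂ, DifferentiableOn ℂ F olssonFPDomain ∧
      Set.EqOn F (olssonFPSeries a b₁ b₂ c₁ c₂) olssonFPDisk := ⟨H, hH, h⟩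
  have hF := hex.choose_spec
  rw [olssonFP, analyticContinuation, dif_pos hex]
  set F := hex.choose
  have hFH : Set.EqOn F H olssonFPDisk := hF.2.trans h.symm
  have hb1 : Metric.ball (0 : ℂ) 1 ⊆ planeMinusOneInfty := fun z hz =>
    mem_planeMinusOneInfty_of_norm_lt_one (by simpa using hz)
  have hb2 : Metric.ball (1 : ℂ) 1 ⊆ planeMinusNegReals := by
    rw [planeMinusNegReals_eq]; exact Complex.ball_one_subset_slitPlane
  rintro ⟨x, y⟩ ⟨hx, hy⟩
  have hx' : ∀ y ∈ Metric.ball (1 : ℂ) 1, F (x, y) = H (x, y) := fun y hy =>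
    eqOn_of_eqOn_open (f := fun x => F (x, y)) (g := fun x => H (x, y))
      isOpen_planeMinusOneInfty isPreconnected_planeMinusOneInfty Metric.isOpen_ball hb1
      ⟨0, by simp⟩
      (hF.1.comp (f := fun x => (x, y)) (by fun_prop) fun x hx => ⟨hx, hb2 hy⟩)
      (hH.comp (f := fun x => (x, y)) (by fun_prop) fun x hx => ⟨hx, hb2 hy⟩)
      (fun x hx => hFH ⟨hx, hy⟩) hx
  exact eqOn_of_eqOn_open (f := fun y => F (x, y)) (g := fun y => H (x, y))
    (planeMinusNegReals_eq ▸ Complex.isOpen_slitPlane)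
    (planeMinusNegReals_eq ▸ isPreconnected_slitPlane) Metric.isOpen_ball hb2 ⟨1, by simp⟩
    (hF.1.comp (f := fun y => (x, y)) (by fun_prop) fun y hy => ⟨hx, hy⟩)
    (hH.comp (f := fun y => (x, y)) (by fun_prop) fun y hy => ⟨hx, hy⟩) hx' hy

theorem mainTheorem5 (a b₁ b₂ c₁ c₂ : ℂ)
    (ha : 0 < a.re) (hac : 0 < (a - c₂ + 1).re) (hbca : 0 < (b₂ + c₁ - a).re)
    (hc₁ : ∀ n : ℕ, c₁ ≠ -(n : ℂ)) (hden : ∀ n : ℕ, a + b₂ - c₂ + 1 ≠ -(n : ℂ)) :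
    DifferentiableOn ℂ (olssonFP a b₁ b₂ c₁ c₂) olssonFPDomain ∧
    Set.EqOn (olssonFP a b₁ b₂ c₁ c₂) (olssonFPSeries a b₁ b₂ c₁ c₂) olssonFPDisk ∧
    ∀ x y : ℂ, x ∉ ((↑) : ℝ → ℂ) '' Set.Ici 1 → y ∉ ((↑) : ℝ → ℂ) '' Set.Iic 0 →
      IntervalIntegrable (olssonFPIntegrand a b₁ b₂ c₁ c₂ x y) MeasureTheory.volume 0 1 ∧
      olssonFP a b₁ b₂ c₁ c₂ (x, y) =
        Complex.Gamma c₁ * Complex.Gamma (a + b₂ - c₂ + 1) /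
            (Complex.Gamma a * Complex.Gamma (a - c₂ + 1) * Complex.Gamma (b₂ + c₁ - a)) *
          (y ^ (-b₂) * ∫ u in (0 : ℝ)..1, olssonFPIntegrand a b₁ b₂ c₁ c₂ x y u) := by
  -- For these parameters the condition `Re (α - a) < Re β` is exactly `Re (a - c₂ + 1) > 0`.
  have hdom : ∀ p ∈ olssonFPDomain,
      (b₂ - c₂ + 1, b₂ + c₁ - a, p.1, p.2) ∈ fpDomain a b₂ := fun p hp =>
    ⟨by simp at hac ⊢; linarith, hbca, hp.1, planeMinusNegReals_eq ▸ hp.2⟩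
  set H : ℂ × ℂ → ℂ := fun p => fpConstant a b₂ c₁ c₂ *
    (p.2 ^ (-b₂) * fpIntegral a b₁ b₂ (b₂ - c₂ + 1) (b₂ + c₁ - a) p.1 p.2) with hHdef
  have hH : DifferentiableOn ℂ H olssonFPDomain := by
    refine DifferentiableOn.const_mul (DifferentiableOn.mul ?_ ?_) _
    · intro p hp
      exact (DifferentiableAt.cpow_const (by fun_prop)
        (planeMinusNegReals_eq ▸ hp.2)).differentiableWithinAt
    · exact (differentiableOn_fpIntegral ha b₁ (α := b₂)).comp
        (f := fun p : ℂ × ℂ => (b₂ - c₂ + 1, b₂ + c₁ - a, p.1, p.2)) (by fun_prop) hdom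
  have hHs : Set.EqOn H (olssonFPSeries a b₁ b₂ c₁ c₂) olssonFPDisk := by
    rintro ⟨x, y⟩ ⟨hx, hy⟩
    refine fpConstant_mul_fpIntegral_eq_olssonFPSeries ha hac hbca hc₁ hden (by simpa using hx) ?_
    rw [norm_sub_rev]
    simpa [dist_eq_norm] using hy
  have hFH := olssonFP_eqOn hH hHs
  have hsub : olssonFPDisk ⊆ olssonFPDomain := by
    refine Set.prod_mono (fun z hz => mem_planeMinusOneInfty_of_norm_lt_one (by simpa using hz)) ?_
    rw [planeMinusNegReals_eq]
    exact Complex.ball_one_subset_slitPlane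
  refine ⟨hH.congr hFH, (hFH.mono hsub).trans hHs, fun x y hx hy => ?_⟩
  have hp : (x, y) ∈ olssonFPDomain := ⟨hx, hy⟩
  refine ⟨?_, ?_⟩
  · rw [intervalIntegrable_iff_integrableOn_Ioo_of_le zero_le_one]
    have hi := integrableOn_fpIntegrand ha b₁ (hdom (x, y) hp)
    exact hi
  · have e₁ : olssonFP a b₁ b₂ c₁ c₂ (x, y) = H (x, y) := hFH hp
    have e₂ : ∫ u in (0 : ℝ)..1, olssonFPIntegrand a b₁ b₂ c₁ c₂ x y u =
        fpIntegral a b₁ b₂ (b₂ - c₂ + 1) (b₂ + c₁ - a) x y := by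
      rw [intervalIntegral.integral_of_le zero_le_one, integral_Ioc_eq_integral_Ioo]
      rfl
    rw [e₁, e₂, hHdef, fpConstant]
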